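/- Let $0<r_1<r_2<\infty$, $A=\{\zeta\in\mathbb C: r_1\le|\zeta|\le r_2\}$ and $\tilde A=\{(z,\bar z): z\in A\}\subset\mathbb C^2$. For $a\in\mathbb C$ and $\rho>0$ put $$\Lambda^+_{a,\rho}=\{(z,w)\in\mathbb C^2: (z-a)(w-\bar a)=\rho^2,\ 0<|z-a|<\rho\},\qquad \Lambda^-_{a,\rho}=\{(z,w)\in\mathbb C^2: (z-a)(w-\bar a)=\rho^2,\ |z-a|>\rho\}.$$ Say that the circle $\{|\zeta-a|=\rho\}$ surrounds the origin if $|a|<\rho$, and let $\Omega^\pm(A)$ be the union of all $\Lambda^\pm_{a,\rho}$ such that the circle $\{|\zeta-a|=\rho\}$ is contained in the interior of $A$ and surrounds the origin. Theorem 7.1. Let $f:A\to\mathbb C$ be a continuous function such that $$\frac1{2\pi}\int_0^{2\pi}f(a+\rho e^{i\theta})\,d\theta=0$$ for every circle $\{|\zeta-a|=\rho\}\subset A$ ($\rho>0$) which surrounds the origin. Then $\tilde A\subset\overline{\Omega^+(A)}$, and there are a holomorphic function $F^+$ on $\Omega^+(A)$, a holomorphic function $F^-$ on $\Omega^-(A)$,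 and a bounded continuous function $\Psi:\overline{\Omega^+(A)}\to\mathbb C$ such that $$\Psi(z,w)=F^+(z,w)+F^-(\bar w,\bar z)\quad((z,w)\in\Omega^+(A)),\qquad \Psi(z,\bar z)=f(z)\quad(z\in A).$$ Moreover $\Psi$ is pluriharmonic on $\Omega^+(A)$, that is, of class $C^2$ there and harmonic along every complex line. -/

import Mathlib

open ComplexConjugate

/-- The closed annulus `A = {ζ : r₁ ≤ |ζ| ≤ r₂}` centred at the origin. -/
def closedAnnulus (r₁ r₂ : ℝ) : Set ℂ := {ζ | r₁ ≤ ‖ζ‖ ∧ ‖ζ‖ ≤ r₂}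

/-- The component `Λ⁺_{a,ρ}` of the part of `(z - a)(w - ā) = ρ²` off `{w = z̄}` on which
`0 < |z - a| < ρ`. -/
def lambdaPlus (a : ℂ) (ρ : ℝ) : Set (ℂ × ℂ) :=
  {p | (p.1 - a) * (p.2 - conj a) = (ρ : ℂ) ^ 2 ∧ 0 < ‖p.1 - a‖ ∧ ‖p.1 - a‖ < ρ}

/-- The component `Λ⁻_{a,ρ}` of the part of `(z - a)(w - ā) = ρ²` off `{w = z̄}` on which
`ρ < |z - a|`. -/
def lambdaMinus (a : ℂ) (ρ : ℝ) : Set (ℂ × ℂ) :=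
  {p | (p.1 - a) * (p.2 - conj a) = (ρ : ℂ) ^ 2 ∧ ρ < ‖p.1 - a‖}

/-- The circle with centre `a` and radius `ρ > 0` lies in `S` and surrounds the origin. -/
def IsSurroundingCircle (S : Set ℂ) (a : ℂ) (ρ : ℝ) : Prop :=
  0 < ρ ∧ Metric.sphere a ρ ⊆ S ∧ (0 : ℂ) ∈ Metric.ball a ρ

/-- `Ω⁺(A)`: the union of all `Λ⁺_{a,ρ}` over circles in `Int A` surrounding the origin. -/
def omegaPlus (A : Set ℂ) : Set (ℂ × ℂ) :=
  {p | ∃ a ρ, IsSurroundingCircle (interior A) a ρ ∧ p ∈ lambdaPlus a ρ}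

/-- `Ω⁻(A)`: the union of all `Λ⁻_{a,ρ}` over circles in `Int A` surrounding the origin. -/
def omegaMinus (A : Set ℂ) : Set (ℂ × ℂ) :=
  {p | ∃ a ρ, IsSurroundingCircle (interior A) a ρ ∧ p ∈ lambdaMinus a ρ}

/-- The lift `Ã = {(z, z̄) : z ∈ A}` of `A` to the totally real plane `{w = z̄}`. -/
def conjLift (A : Set ℂ) : Set (ℂ × ℂ) := {p | p.1 ∈ A ∧ p.2 = conj p.1}

/-- A complex-valued function on an open set `U ⊆ ℂ²` is pluriharmonic if it is of class `C²` and
its restriction to (the part in `U` of) every complex affine line is harmonic. -/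
def PluriharmonicOn (u : ℂ × ℂ → ℂ) (U : Set (ℂ × ℂ)) : Prop :=
  ContDiffOn ℝ 2 u U ∧
    ∀ p v : ℂ × ℂ,
      InnerProductSpace.HarmonicOnNhd (fun ζ : ℂ => u (p + ζ • v)) {ζ : ℂ | p + ζ • v ∈ U}

open Filter Topology Metric Complex

/-! The leaf of a circle is a punctured disc in `z` along which `w⁻¹` is a Möbius function of `z`:
it vanishes at the centre and equals `1 / conj z` on the circle. Hence a function `p (z, w⁻¹)` with
`p` entire is holomorphic on each leaf and extends across the puncture, and its boundary values are
those of `p (z, (conj z)⁻¹)`. If `f` on the annulus is such a function plus the analogous `q (conj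
z, z⁻¹)`, the theorem is immediate. The general case is a limit of this one.

Density. Convolving `f` in the angle with powers of `(1 + cos α) / 2` approximates it uniformly by
finite sums of rotation components, and these still have zero means. The component of degree `n ≥ 0`
is `g (log |ζ|²) / conj ζ ^ n`, and `ZeroMeansOn.eq_sum_exp` shows that `g` is a polynomial in
`|ζ|²` of degree less than `n`. So the component is a sum of terms `ζ ^ j * (conj ζ)⁻¹ ^ (n - j)`
with `j < n`, which vanish when `w⁻¹ = 0`. Negative degrees follow by conjugation.

Limits. On each leaf the maximum principle bounds the sum of the two lifts by its supremum on the
circle, so the sums converge uniformly on the closure of `Ω⁺`. Both summands vanish at the centre of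
the leaf, so Borel–Carathéodory bounds the holomorphic one separately, by a constant depending only
on `‖z - a‖ / ρ` (`leaf_estimates`). Through all points near a given one pass leaves with the same
ratio (`exists_ball_lambdaPlus`). The holomorphic parts therefore converge locally uniformly. -/

/-! ### Estimates on discs and on leaves -/

/-- A maximum principle for a sum of a holomorphic and an antiholomorphic function. -/
theorem norm_add_conj_le_of_sphere {P Q : ℂ → ℂ} {a : ℂ} {ρ M : ℝ} (hρ : 0 < ρ)
    (hP : DiffContOnCl ℂ P (ball a ρ)) (hQ : DiffContOnCl ℂ Q (ball a ρ))
    (hM : ∀ ζ ∈ sphere a ρ, ‖P ζ + conj (Q ζ)‖ ≤ M) {z : ℂ} (hz : z ∈ closedBall a ρ) :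
    ‖P z + conj (Q z)‖ ≤ M := by
  -- A unimodular `c` rotates the value at `z` onto the nonnegative real axis. The real part of `c *
  -- (P + conj Q)` is that of the holomorphic `c * P + conj c * Q`, so the maximum modulus principle
  -- applies to the exponential of the latter.
  obtain ⟨c, hc, hcz⟩ : ∃ c : ℂ, ‖c‖ = 1 ∧
      ‖P z + conj (Q z)‖ = (c * (P z + conj (Q z))).re := by
    by_cases h0 : P z + conj (Q z) = 0
    · exact ⟨1, by simp, by simp [h0]⟩
    · refine ⟨conj (P z + conj (Q z)) / ‖P z + conj (Q z)‖, ?_, ?_⟩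
      · rw [norm_div, RCLike.norm_conj]; simp [h0]
      · rw [div_mul_eq_mul_div, mul_comm, mul_conj, normSq_eq_norm_sq]
        norm_cast
        field_simp
  have hre : ∀ ζ, (c * P ζ + conj c * Q ζ).re = (c * (P ζ + conj (Q ζ))).re := by
    intro ζ; simp; ring
  have hd : DiffContOnCl ℂ (fun ζ => exp (c * P ζ + conj c * Q ζ)) (ball a ρ) :=
    Differentiable.comp_diffContOnCl (g := fun ζ => c * P ζ + conj c * Q ζ) differentiable_exp
      ((hP.const_smul c).add (hQ.const_smul (conj c)))
  have key : ‖exp (c * P z + conj c * Q z)‖ ≤ Real.exp M := by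
    refine norm_le_of_forall_mem_frontier_norm_le isBounded_ball hd ?_
      (by rwa [closure_ball a hρ.ne'])
    intro ζ hζ
    rw [frontier_ball a hρ.ne'] at hζ
    rw [norm_exp, hre]
    refine Real.exp_le_exp.2 ((re_le_norm _).trans ?_)
    rw [norm_mul, hc, one_mul]
    exact hM ζ hζ
  rw [norm_exp, Real.exp_le_exp, hre] at key
  rw [hcz]; exact key

theorem norm_le_of_re_le {H : ℂ → ℂ} {a : ℂ} {ρ M : ℝ} (hM : 0 ≤ M)
    (hH : DifferentiableOn ℂ H (ball a ρ)) (hre : ∀ ζ ∈ ball a ρ, (H ζ).re ≤ M) (ha : H a = 0)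
    {z : ℂ} (hz : z ∈ ball a ρ) : ‖H z‖ ≤ 2 * M * ‖z - a‖ / (ρ - ‖z - a‖) := by
  have hρ : 0 < ρ := (norm_nonneg _).trans_lt (mem_ball_iff_norm.1 hz)
  have hz' : ‖z - a‖ < ρ := mem_ball_iff_norm.1 hz
  -- Borel–Carathéodory needs a positive bound, while `M` may be zero; let `M'` decrease to `M`.
  have hpos : ∀ M' > M, ‖H z‖ ≤ 2 * M' * ‖z - a‖ / (ρ - ‖z - a‖) := by
    intro M' hM'
    have hmaps : Set.MapsTo (fun ζ => ζ + a) (ball 0 ρ) (ball a ρ) := by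
      intro ζ hζ; simpa [mem_ball_iff_norm] using hζ
    have := borelCaratheodory_zero (f := fun ζ => H (ζ + a)) (M := M') (R := ρ) (z := z - a)
      (hM.trans_lt hM') (hH.comp (by fun_prop) hmaps)
      (fun ζ hζ => (hre _ (hmaps hζ)).trans hM'.le) hρ (by simpa using hz') (by simpa using ha)
    simpa using this
  have hlim : Tendsto (fun M' : ℝ => 2 * M' * ‖z - a‖ / (ρ - ‖z - a‖)) (𝓝[>] M)
      (𝓝 (2 * M * ‖z - a‖ / (ρ - ‖z - a‖))) := by
    refine tendsto_nhdsWithin_of_tendsto_nhds (Continuous.tendsto ?_ _)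
    fun_prop
  exact ge_of_tendsto hlim (eventually_mem_nhdsWithin.mono hpos)

/-- The holomorphic part of a bounded harmonic function on a disc is bounded on smaller discs. -/
theorem norm_le_of_norm_add_conj_le {P Q : ℂ → ℂ} {a : ℂ} {ρ M : ℝ} (hM0 : 0 ≤ M)
    (hP : DifferentiableOn ℂ P (ball a ρ)) (hQ : DifferentiableOn ℂ Q (ball a ρ))
    (hPa : P a = 0) (hQa : Q a = 0)
    (hM : ∀ ζ ∈ ball a ρ, ‖P ζ + conj (Q ζ)‖ ≤ M) {z : ℂ} (hz : z ∈ ball a ρ) :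
    ‖P z‖ ≤ 2 * M * ‖z - a‖ / (ρ - ‖z - a‖) := by
  -- The real parts of `P + Q` and `I * (P - Q)` are the real part and minus the imaginary part of
  -- `P + conj Q`, so both are at most `M`; and `P` is half the sum of `P + Q` and `P - Q`.
  have h1 := norm_le_of_re_le hM0 (hP.add hQ) (fun ζ hζ => by
    refine le_trans (le_of_eq ?_) ((re_le_norm _).trans (hM ζ hζ))
    simp) (by simp [hPa, hQa]) hz
  have h2 := norm_le_of_re_le hM0 ((hP.sub hQ).const_mul I) (fun ζ hζ => by
    refine le_trans (le_of_eq ?_) (((abs_le.1 (abs_im_le_norm _)).1.trans' (neg_le_neg (hM ζ hζ))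
      |> neg_le.1))
    simp; ring) (by simp [hPa, hQa]) hz
  rw [norm_mul, norm_I, one_mul] at h2
  have h3 : P z = ((P + Q) z + (P - Q) z) / 2 := by simp
  rw [h3, norm_div]
  have := norm_add_le ((P + Q) z) ((P - Q) z)
  simp only [Complex.norm_ofNat]
  linarith

/-- The real derivative is a complex linear map conjugated on both sides, which is again complex
linear. -/
theorem differentiableAt_conj_comp_conj {q : ℂ × ℂ → ℂ} {x : ℂ × ℂ}
    (hq : DifferentiableAt ℂ q (conj x.1, conj x.2)) :
    DifferentiableAt ℂ (fun x : ℂ × ℂ => conj (q (conj x.1, conj x.2))) x := by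
  let c : ℂ × ℂ →L[ℝ] ℂ × ℂ := (conjCLE : ℂ →L[ℝ] ℂ).prodMap (conjCLE : ℂ →L[ℝ] ℂ)
  have hqc : DifferentiableAt ℂ q (c x) := hq
  let D : ℂ × ℂ →L[ℂ] ℂ := fderiv ℂ q (c x)
  let D' : ℂ × ℂ →ₗ[ℂ] ℂ :=
    { toFun := fun v => conj (D (c v))
      map_add' := fun v w => by simp
      map_smul' := fun r v => by
        have : c (r • v) = conj r • c v := by ext <;> simp [c]
        rw [this, map_smul]; simp }
  have h : HasFDerivAt (fun x : ℂ × ℂ => conj (q (c x)))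
      ((conjCLE : ℂ →L[ℝ] ℂ).comp ((D.restrictScalars ℝ).comp c)) x :=
    (conjCLE : ℂ →L[ℝ] ℂ).hasFDerivAt.comp x
      ((hqc.hasFDerivAt.restrictScalars ℝ).comp x c.hasFDerivAt)
  have h' : HasFDerivAt (fun x : ℂ × ℂ => conj (q (c x))) (LinearMap.toContinuousLinearMap D') x :=
    hasFDerivAt_of_restrictScalars ℝ h (ContinuousLinearMap.ext fun v => rfl)
  exact h'.differentiableAt

/-- Estimates on a leaf `Λ⁺_{a,ρ}` in terms of the values on the circle. -/
theorem leaf_estimates {p q : ℂ × ℂ → ℂ} (hp : Differentiable ℂ p) (hq : Differentiable ℂ q)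
    (hp0 : ∀ z, p (z, 0) = 0) (hq0 : ∀ z, q (z, 0) = 0) {a : ℂ} {ρ M : ℝ} (haρ : ‖a‖ < ρ)
    (hM : ∀ ζ ∈ sphere a ρ, ‖p (ζ, (conj ζ)⁻¹) + q (conj ζ, ζ⁻¹)‖ ≤ M) {z w : ℂ}
    (hzw : (z, w) ∈ lambdaPlus a ρ) :
    ‖p (z, w⁻¹) + q (conj z, (conj w)⁻¹)‖ ≤ M ∧
      ‖p (z, w⁻¹)‖ ≤ 2 * M * ‖z - a‖ / (ρ - ‖z - a‖) := by
  have hρ : 0 < ρ := (norm_nonneg a).trans_lt haρ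
  obtain ⟨h1, h2, h3⟩ := hzw
  simp only at h1 h2 h3
  -- This is `w⁻¹` solved from the leaf equation. Its pole lies outside the closed disc because `‖a‖
  -- < ρ`.
  set W : ℂ → ℂ := fun ζ => (ζ - a) / (conj a * (ζ - a) + (ρ : ℂ) ^ 2) with hW
  have hden : ∀ ζ ∈ closedBall a ρ, conj a * (ζ - a) + (ρ : ℂ) ^ 2 ≠ 0 := by
    intro ζ hζ h
    have hζ' : ‖ζ - a‖ ≤ ρ := mem_closedBall_iff_norm.1 hζ
    have : ‖conj a * (ζ - a)‖ = ρ ^ 2 := by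
      rw [eq_neg_of_add_eq_zero_left h, norm_neg, norm_pow]; simp
    rw [norm_mul, RCLike.norm_conj] at this
    nlinarith [norm_nonneg a, norm_nonneg (ζ - a)]
  have hWd : DiffContOnCl ℂ W (ball a ρ) := by
    refine DifferentiableOn.diffContOnCl_ball (U := closedBall a ρ) ?_ subset_rfl
    exact DifferentiableOn.div (by fun_prop) (by fun_prop) hden
  have hWa : W a = 0 := by simp [hW]
  have hWs : ∀ ζ ∈ sphere a ρ, W ζ = (conj ζ)⁻¹ := by
    intro ζ hζ
    have hζ' : ‖ζ - a‖ = ρ := mem_sphere_iff_norm.1 hζ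
    have hne : ζ - a ≠ 0 := by rw [← norm_pos_iff, hζ']; exact hρ
    have : conj a * (ζ - a) + (ρ : ℂ) ^ 2 = (ζ - a) * conj ζ := by
      rw [← hζ', ← mul_conj']; simp only [map_sub]; ring
    rw [hW]; simp only
    rw [this, div_mul_eq_div_div, div_self hne, one_div]
  have hzne : z - a ≠ 0 := norm_pos_iff.1 h2
  have hWz : W z = w⁻¹ := by
    have : conj a * (z - a) + (ρ : ℂ) ^ 2 = (z - a) * w := by rw [← h1]; ring
    rw [hW]; simp only
    rw [this, div_mul_eq_div_div, div_self hzne, one_div]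
  have hPd : DiffContOnCl ℂ (fun ζ => p (ζ, W ζ)) (ball a ρ) :=
    hp.comp_diffContOnCl ⟨differentiableOn_id.prodMk hWd.1, continuousOn_id.prodMk hWd.2⟩
  have hq' : Differentiable ℂ (fun x : ℂ × ℂ => conj (q (conj x.1, conj x.2))) :=
    fun _ => differentiableAt_conj_comp_conj (hq _)
  have hQd : DiffContOnCl ℂ (fun ζ => conj (q (conj ζ, conj (W ζ)))) (ball a ρ) :=
    hq'.comp_diffContOnCl (f := fun x : ℂ × ℂ => conj (q (conj x.1, conj x.2)))
      (g := fun ζ => (ζ, W ζ)) ⟨differentiableOn_id.prodMk hWd.1, continuousOn_id.prodMk hWd.2⟩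
  have hzb : z ∈ ball a ρ := mem_ball_iff_norm.2 h3
  have hmax : ∀ ζ ∈ closedBall a ρ,
      ‖p (ζ, W ζ) + conj (conj (q (conj ζ, conj (W ζ))))‖ ≤ M := by
    intro ζ hζ
    refine norm_add_conj_le_of_sphere hρ hPd hQd ?_ hζ
    intro ξ hξ
    rw [conj_conj, hWs ξ hξ]
    simpa using hM ξ hξ
  have hM0 : 0 ≤ M := (norm_nonneg _).trans (hmax z (ball_subset_closedBall hzb))
  refine ⟨?_, ?_⟩
  · have := hmax z (ball_subset_closedBall hzb)
    rw [conj_conj, hWz, map_inv₀] at this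
    exact this
  · have := norm_le_of_norm_add_conj_le hM0 hPd.1 hQd.1 (by simp [hWa, hp0]) (by simp [hWa, hq0])
      (fun ζ hζ => hmax ζ (ball_subset_closedBall hζ)) hzb
    simp only [hWz] at this
    exact this

/-! ### Locally uniform limits of holomorphic functions of several variables -/

/-- Cauchy's estimate for the derivative of a holomorphic function of several variables. -/
theorem norm_fderiv_le_of_forall_mem_ball {E F : Type*} [NormedAddCommGroup E] [NormedSpace ℂ E]
    [NormedAddCommGroup F] [NormedSpace ℂ F] {f : E → F} {x : E} {r C : ℝ} (hr : 0 < r)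
    (hC : 0 ≤ C) (hf : DifferentiableOn ℂ f (ball x r)) (hb : ∀ y ∈ ball x r, ‖f y‖ ≤ C) :
    ‖fderiv ℂ f x‖ ≤ 2 * C / r := by
  refine ContinuousLinearMap.opNorm_le_bound _ (by positivity) fun v => ?_
  rcases eq_or_ne v 0 with rfl | hv
  · simp
  have hv' : 0 < ‖v‖ := norm_pos_iff.2 hv
  have hmaps : ∀ t ∈ ball (0 : ℂ) (r / ‖v‖), x + t • v ∈ ball x r := by
    intro t ht
    rw [mem_ball_zero_iff, lt_div_iff₀ hv'] at ht
    simpa [mem_ball_iff_norm, norm_smul] using ht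
  -- The one-variable estimate needs a closed disc inside the domain; halving the radius produces
  -- the factor 2 in the bound.
  have hR : 0 < r / ‖v‖ / 2 := by positivity
  have hsub : closedBall (0 : ℂ) (r / ‖v‖ / 2) ⊆ ball 0 (r / ‖v‖) :=
    closedBall_subset_ball (by linarith)
  have hd : DifferentiableOn ℂ (fun t : ℂ => f (x + t • v)) (ball 0 (r / ‖v‖)) :=
    hf.comp (by fun_prop) hmaps
  have h1 := norm_deriv_le_of_forall_mem_sphere_norm_le hR
    (hd.diffContOnCl_ball hsub) (fun t ht => hb _ (hmaps t (hsub (sphere_subset_closedBall ht))))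
  have h2 : HasDerivAt (fun t : ℂ => f (x + t • v)) (fderiv ℂ f x v) 0 := by
    have hfx : HasFDerivAt f (fderiv ℂ f x) (x + (0 : ℂ) • v) := by
      simpa using (hf.differentiableAt (ball_mem_nhds x hr)).hasFDerivAt
    have := hfx.comp_hasDerivAt (0 : ℂ) (((hasDerivAt_id (0 : ℂ)).smul_const v).const_add x)
    simpa [Function.comp_def] using this
  rw [h2.deriv] at h1
  refine h1.trans (le_of_eq ?_)
  field_simp

theorem uniformCauchySeqOn_fderiv_ball {E F : Type*} [NormedAddCommGroup E] [NormedSpace ℂ E]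
    [NormedAddCommGroup F] [NormedSpace ℂ F] {f : ℕ → E → F} {x : E} {r : ℝ} (hr : 0 < r)
    (hf : ∀ n, DifferentiableOn ℂ (f n) (ball x (2 * r)))
    (hc : UniformCauchySeqOn f atTop (ball x (2 * r))) :
    UniformCauchySeqOn (fun n => fderiv ℂ (f n)) atTop (ball x r) := by
  rw [Metric.uniformCauchySeqOn_iff] at hc ⊢
  intro ε hε
  obtain ⟨N, hN⟩ := hc (ε * r / 4) (by positivity)
  refine ⟨N, fun m hm n hn y hy => ?_⟩
  have hsub : ball y r ⊆ ball x (2 * r) := by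
    refine ball_subset_ball' ?_
    have := mem_ball.1 hy
    linarith
  have hy2 : y ∈ ball x (2 * r) := hsub (mem_ball_self hr)
  have h1 := norm_fderiv_le_of_forall_mem_ball hr (C := ε * r / 4) (by positivity)
    (((hf m).sub (hf n)).mono hsub)
    (fun u hu => by simpa [dist_eq_norm] using (hN m hm n hn u (hsub hu)).le)
  rw [fderiv_sub ((hf m).differentiableAt (isOpen_ball.mem_nhds hy2))
    ((hf n).differentiableAt (isOpen_ball.mem_nhds hy2))] at h1
  rw [dist_eq_norm]
  refine h1.trans_lt ?_
  field_simp
  linarith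

/-- Locally uniform limits of holomorphic functions of several variables are holomorphic and
the derivatives converge locally uniformly. -/
theorem differentiableOn_and_fderiv_of_tendstoUniformlyOn_ball {E F : Type*}
    [NormedAddCommGroup E] [NormedSpace ℂ E] [NormedAddCommGroup F] [NormedSpace ℂ F]
    [CompleteSpace F] {f : ℕ → E → F} {g : E → F} {U : Set E}
    (hf : ∀ n, DifferentiableOn ℂ (f n) U)
    (hg : ∀ x ∈ U, ∃ r > 0, ball x r ⊆ U ∧ TendstoUniformlyOn f g atTop (ball x r)) :
    DifferentiableOn ℂ g U ∧ ∀ x ∈ U, ∃ r > 0, ball x r ⊆ U ∧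
      TendstoUniformlyOn (fun n => fderiv ℂ (f n)) (fderiv ℂ g) atTop (ball x r) := by
  have key : ∀ x ∈ U, ∃ r > 0, ball x r ⊆ U ∧ (∀ y ∈ ball x r, DifferentiableAt ℂ g y) ∧
      TendstoUniformlyOn (fun n => fderiv ℂ (f n)) (fderiv ℂ g) atTop (ball x r) := by
    intro x hx
    obtain ⟨R, hR, hRU, hru⟩ := hg x hx
    obtain ⟨r, hr, rfl⟩ : ∃ r > 0, R = 2 * r := ⟨R / 2, by positivity, by ring⟩
    have hc := uniformCauchySeqOn_fderiv_ball hr (fun n => (hf n).mono hRU) hru.uniformCauchySeqOn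
    have hsub : ball x r ⊆ ball x (2 * r) := ball_subset_ball (by linarith)
    have hlim : ∀ y, ∃ l, y ∈ ball x r → Tendsto (fun n => fderiv ℂ (f n) y) atTop (𝓝 l) := by
      intro y
      by_cases hy : y ∈ ball x r
      · obtain ⟨l, hl⟩ := cauchySeq_tendsto_of_complete (hc.cauchySeq hy)
        exact ⟨l, fun _ => hl⟩
      · exact ⟨0, fun h => absurd h hy⟩
    choose g' hg' using hlim
    have hu := hc.tendstoUniformlyOn_of_tendsto hg'
    have hder : ∀ y ∈ ball x r, HasFDerivAt g (g' y) y := fun y hy =>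
      hasFDerivAt_of_tendstoUniformlyOn isOpen_ball hu
        (fun n y hy => (((hf n).mono hRU).differentiableAt
          (isOpen_ball.mem_nhds (hsub hy))).hasFDerivAt)
        (fun y hy => hru.tendsto_at (hsub hy)) hy
    exact ⟨r, hr, hsub.trans hRU, fun y hy => (hder y hy).differentiableAt,
      hu.congr_right fun y hy => (hder y hy).fderiv.symm⟩
  refine ⟨fun x hx => ?_, fun x hx => ?_⟩
  · obtain ⟨r, hr, -, h, -⟩ := key x hx
    exact (h x (mem_ball_self hr)).differentiableWithinAt
  · obtain ⟨r, hr, h1, -, h2⟩ := key x hx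
    exact ⟨r, hr, h1, h2⟩

/-- Locally uniform limits of smooth holomorphic functions of several variables are smooth. -/
theorem contDiffOn_of_tendstoUniformlyOn_ball {E : Type} [NormedAddCommGroup E]
    [NormedSpace ℂ E] {U : Set E} (hU : IsOpen U) (m : ℕ) :
    ∀ {F : Type} [NormedAddCommGroup F] [NormedSpace ℂ F] [CompleteSpace F]
    {f : ℕ → E → F} {g : E → F}, (∀ n, ∀ k : ℕ, ContDiffOn ℂ k (f n) U) →
    (∀ x ∈ U, ∃ r > 0, ball x r ⊆ U ∧ TendstoUniformlyOn f g atTop (ball x r)) →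
    ContDiffOn ℂ m g U := by
  induction m with
  | zero =>
    intro F _ _ _ f g hf hg
    exact contDiffOn_zero.2 (differentiableOn_and_fderiv_of_tendstoUniformlyOn_ball
      (fun n => (hf n 1).differentiableOn (by simp)) hg).1.continuousOn
  | succ m ih =>
    intro F _ _ _ f g hf hg
    obtain ⟨h1, h2⟩ := differentiableOn_and_fderiv_of_tendstoUniformlyOn_ball
      (fun n => (hf n 1).differentiableOn (by simp)) hg
    rw [Nat.cast_succ, contDiffOn_succ_iff_fderiv_of_isOpen hU]
    -- The derivatives take values in `E →L[ℂ] F`, which is why the induction runs over all target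
    -- spaces.
    refine ⟨h1, by simp, ih (fun n k => ?_) h2⟩
    have := hf n (k + 1)
    rw [Nat.cast_succ, contDiffOn_succ_iff_fderiv_of_isOpen hU] at this
    exact this.2.2

/-! ### Zero means under differentiation and dilation -/

/-- `F` has zero mean on all circles surrounding the origin in `{s₁ < |ζ| < s₂}`. -/
def ZeroMeansOn (s₁ s₂ : ℝ) (F : ℂ → ℂ) : Prop :=
  ∀ (a : ℂ) (ρ : ℝ), ‖a‖ + s₁ < ρ → ρ + ‖a‖ < s₂ →
    ∫ θ in (0 : ℝ)..2 * Real.pi, F (circleMap a ρ θ) = 0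

theorem norm_circleMap_mem {a : ℂ} {ρ : ℝ} (hρ : 0 ≤ ρ) (θ : ℝ) :
    ρ - ‖a‖ ≤ ‖circleMap a ρ θ‖ ∧ ‖circleMap a ρ θ‖ ≤ ρ + ‖a‖ := by
  have h1 : ‖circleMap a ρ θ - a‖ = ρ := by simp [abs_of_nonneg hρ]
  have h2 := norm_sub_le (circleMap a ρ θ) a
  have h3 := norm_add_le (circleMap a ρ θ - a) a
  rw [sub_add_cancel] at h3
  constructor <;> linarith

/-- Directional derivatives of functions with zero means have zero means. -/
theorem ZeroMeansOn.directional_deriv {s₁ s₂ : ℝ} (hs₁ : 0 < s₁) {F D : ℂ → ℂ} {v : ℂ}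
    (hF : ZeroMeansOn s₁ s₂ F)
    (hFc : ContinuousOn F {ζ | s₁ < ‖ζ‖ ∧ ‖ζ‖ < s₂})
    (hD : ContinuousOn D {ζ | s₁ < ‖ζ‖ ∧ ‖ζ‖ < s₂})
    (hd : ∀ ζ, s₁ < ‖ζ‖ → ‖ζ‖ < s₂ → HasDerivAt (fun t : ℝ => F (ζ + t * v)) (D ζ) 0) :
    ZeroMeansOn s₁ s₂ D := by
  intro a ρ h1 h2
  have hρ : 0 < ρ := by linarith [norm_nonneg a]
  obtain ⟨ε, hε, hε1, hε2⟩ : ∃ ε > 0, ‖a‖ + s₁ + ε < ρ ∧ ρ + ‖a‖ + ε < s₂ := by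
    refine ⟨min (ρ - (‖a‖ + s₁)) (s₂ - (ρ + ‖a‖)) / 2, ?_, ?_, ?_⟩
    · have : 0 < min (ρ - (‖a‖ + s₁)) (s₂ - (ρ + ‖a‖)) := lt_min (by linarith) (by linarith)
      linarith
    · have := min_le_left (ρ - (‖a‖ + s₁)) (s₂ - (ρ + ‖a‖)); linarith
    · have := min_le_right (ρ - (‖a‖ + s₁)) (s₂ - (ρ + ‖a‖)); linarith
  set K : Set ℂ := {ζ | ρ - ‖a‖ - ε ≤ ‖ζ‖ ∧ ‖ζ‖ ≤ ρ + ‖a‖ + ε} with hK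
  have hKc : IsCompact K := by
    refine isCompact_of_isClosed_isBounded ?_ ?_
    · exact (isClosed_le continuous_const continuous_norm).inter
        (isClosed_le continuous_norm continuous_const)
    · exact (isBounded_closedBall (x := (0 : ℂ)) (r := ρ + ‖a‖ + ε)).subset
        fun ζ hζ => mem_closedBall_zero_iff.2 hζ.2
  have hKA : K ⊆ {ζ | s₁ < ‖ζ‖ ∧ ‖ζ‖ < s₂} := fun ζ hζ =>
    ⟨by linarith [hζ.1], by linarith [hζ.2]⟩
  obtain ⟨C, hC⟩ := hKc.exists_bound_of_continuousOn (hD.mono hKA)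
  -- For `|t| < τ` the translate by `t * v` moves the circle by at most `ε`, so it stays in `K`. The
  -- added 1 covers `v = 0`.
  set τ : ℝ := ε / (‖v‖ + 1) with hτ
  have hv1 : 0 < ‖v‖ + 1 := by positivity
  have hτ0 : 0 < τ := by positivity
  have hsmall : ∀ t ∈ ball (0 : ℝ) τ, ‖(t : ℂ) * v‖ ≤ ε := by
    intro t ht
    rw [mem_ball_zero_iff, hτ, lt_div_iff₀ hv1] at ht
    rw [norm_mul, Complex.norm_real]
    nlinarith [norm_nonneg t, norm_nonneg v]
  have hmem : ∀ t ∈ ball (0 : ℝ) τ, ∀ θ, circleMap a ρ θ + t * v ∈ K := by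
    intro t ht θ
    have := hsmall t ht
    have h3 := norm_circleMap_mem (a := a) hρ.le θ
    have h4 := norm_add_le (circleMap a ρ θ) (t * v)
    have h5 := norm_sub_le (circleMap a ρ θ + t * v) (t * v)
    rw [add_sub_cancel_right] at h5
    constructor <;> linarith
  have hcont : ∀ {G : ℂ → ℂ}, ContinuousOn G {ζ | s₁ < ‖ζ‖ ∧ ‖ζ‖ < s₂} →
      ∀ t ∈ ball (0 : ℝ) τ, Continuous fun θ : ℝ => G (circleMap a ρ θ + t * v) := by
    intro G hG t ht
    exact hG.comp_continuous (by fun_prop) fun θ => hKA (hmem t ht θ)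
  have h0 : (0 : ℝ) ∈ ball (0 : ℝ) τ := mem_ball_self hτ0
  have key := intervalIntegral.hasDerivAt_integral_of_dominated_loc_of_deriv_le
    (μ := MeasureTheory.volume) (a := 0) (b := 2 * Real.pi)
    (F := fun (t : ℝ) (θ : ℝ) => F (circleMap a ρ θ + t * v))
    (F' := fun (t : ℝ) (θ : ℝ) => D (circleMap a ρ θ + t * v)) (x₀ := 0) (bound := fun _ => C)
    (ball_mem_nhds 0 hτ0)
    (eventually_of_mem (ball_mem_nhds 0 hτ0) fun t ht =>
      (hcont hFc t ht).aestronglyMeasurable)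
    ((hcont hFc 0 h0).intervalIntegrable _ _) (hcont hD 0 h0).aestronglyMeasurable
    (Eventually.of_forall fun θ _ t ht => hC _ (hmem t ht θ))
    intervalIntegrable_const
    (Eventually.of_forall fun θ _ t ht => by
      have hm := hKA (hmem t ht θ)
      have := (hd _ hm.1 hm.2)
      rw [← sub_self t] at this
      have := HasDerivAt.comp_sub_const t t this
      refine this.congr_of_eventuallyEq (Eventually.of_forall fun u => ?_)
      simp only
      congr 1
      push_cast; ring)
  -- Translated circles still surround the origin inside the annulus, so the mean vanishes for all
  -- small `t`, and so does its derivative.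
  have hzero : (fun t : ℝ => ∫ θ in (0 : ℝ)..2 * Real.pi, F (circleMap a ρ θ + t * v))
      =ᶠ[𝓝 0] fun _ => 0 := by
    refine eventually_of_mem (ball_mem_nhds 0 hτ0) fun t ht => ?_
    have h3 := hsmall t ht
    have h4 := norm_add_le a (t * v)
    have := hF (a + t * v) ρ (by linarith) (by linarith)
    rw [← this]
    simp only [circleMap]
    congr 1; ext θ; congr 1; ring
  have := key.2.unique ((hasDerivAt_const (0 : ℝ) (0 : ℂ)).congr_of_eventuallyEq hzero)
  simpa using this

/-- The directional derivative of a function `h(log |ζ|²) / conj ζ ^ n`. -/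
theorem hasDerivAt_comp_log_normSq_div {h : ℝ → ℂ} {h' : ℂ} {ζ : ℂ} (hζ : ζ ≠ 0) (n : ℕ)
    (hh : HasDerivAt h h' (Real.log (normSq ζ))) (v : ℂ) :
    HasDerivAt (fun t : ℝ => h (Real.log (normSq (ζ + t * v))) / conj (ζ + t * v) ^ (n + 1))
      (h' * (2 * (ζ.re * v.re + ζ.im * v.im) / normSq ζ : ℝ) / conj ζ ^ (n + 1)
        - (n + 1) * h (Real.log (normSq ζ)) * conj v / conj ζ ^ (n + 2)) 0 := by
  have hcζ : conj ζ ≠ 0 := (map_ne_zero _).2 hζ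
  have hN : HasDerivAt (fun t : ℝ => normSq (ζ + t * v))
      (2 * (ζ.re * v.re + ζ.im * v.im)) 0 := by
    have h1 : HasDerivAt (fun t : ℝ => (ζ.re + t * v.re) * (ζ.re + t * v.re)
        + (ζ.im + t * v.im) * (ζ.im + t * v.im)) (2 * (ζ.re * v.re + ζ.im * v.im)) 0 := by
      have hre : HasDerivAt (fun t : ℝ => ζ.re + t * v.re) v.re 0 := by
        simpa using ((hasDerivAt_id (0 : ℝ)).mul_const v.re).const_add ζ.re
      have him : HasDerivAt (fun t : ℝ => ζ.im + t * v.im) v.im 0 := by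
        simpa using ((hasDerivAt_id (0 : ℝ)).mul_const v.im).const_add ζ.im
      exact ((hre.fun_mul hre).fun_add (him.fun_mul him)).congr_deriv (by simp; ring)
    refine h1.congr_of_eventuallyEq (Eventually.of_forall fun t => ?_)
    simp [normSq_apply]
  have hL : HasDerivAt (fun t : ℝ => Real.log (normSq (ζ + t * v)))
      (2 * (ζ.re * v.re + ζ.im * v.im) / normSq ζ) 0 := by
    have := hN.log (by simpa using hζ)
    simpa using this
  have hC : HasDerivAt (fun t : ℝ => conj (ζ + t * v) ^ (n + 1))
      ((n + 1) * conj ζ ^ n * conj v) 0 := by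
    have h1 : HasDerivAt (fun t : ℝ => conj ζ + (t : ℂ) * conj v) (conj v) 0 := by
      simpa using ((hasDerivAt_id (0 : ℝ)).ofReal_comp.mul_const (conj v)).const_add (conj ζ)
    have h2 := (h1.fun_pow (n + 1)).congr_deriv
      (g' := (n + 1) * conj ζ ^ n * conj v) (by simp)
    simpa using h2
  have hcomp : HasDerivAt (fun t : ℝ => h (Real.log (normSq (ζ + t * v))))
      ((2 * (ζ.re * v.re + ζ.im * v.im) / normSq ζ : ℝ) • h') 0 := by
    have hh0 : HasDerivAt h h' (Real.log (normSq (ζ + (0 : ℝ) * v))) := by simpa using hh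
    exact hh0.scomp (0 : ℝ) hL
  refine (hcomp.fun_div hC (by simpa using hcζ)).congr_deriv ?_
  simp only [real_smul, ofReal_zero, zero_mul, add_zero]
  field_simp
  ring

theorem continuousOn_comp_log_normSq {h : ℝ → ℂ} (hh : Continuous h) {S : Set ℂ}
    (hS : ∀ ζ ∈ S, ζ ≠ 0) : ContinuousOn (fun ζ => h (Real.log (normSq ζ))) S :=
  hh.comp_continuousOn (ContinuousOn.log continuous_normSq.continuousOn
    fun ζ hζ => (map_ne_zero _).2 (hS ζ hζ))

/-- The Wirtinger derivative `∂/∂ζ` lowers the degree. -/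
theorem ZeroMeansOn.wirtinger_deriv {s₁ s₂ : ℝ} (hs₁ : 0 < s₁) {h h' : ℝ → ℂ} {n : ℕ}
    (hh : ∀ x, HasDerivAt h (h' x) x) (hh' : Continuous h')
    (hF : ZeroMeansOn s₁ s₂ fun ζ => h (Real.log (normSq ζ)) / conj ζ ^ (n + 1)) :
    ZeroMeansOn s₁ s₂ fun ζ =>
      (fun x : ℝ => h' x * Real.exp (-x)) (Real.log (normSq ζ)) / conj ζ ^ n := by
  have hhc : Continuous h := continuous_iff_continuousAt.2 fun x => (hh x).continuousAt
  have hne : ∀ ζ ∈ {ζ : ℂ | s₁ < ‖ζ‖ ∧ ‖ζ‖ < s₂}, ζ ≠ 0 := fun ζ hζ =>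
    norm_pos_iff.1 (hs₁.trans hζ.1)
  set D : ℂ → ℂ → ℂ := fun v ζ => h' (Real.log (normSq ζ)) *
      (2 * (ζ.re * v.re + ζ.im * v.im) / normSq ζ : ℝ) / conj ζ ^ (n + 1)
        - (n + 1) * h (Real.log (normSq ζ)) * conj v / conj ζ ^ (n + 2) with hD
  have hcc : Continuous fun ζ : ℂ => conj ζ := continuous_conj
  have hDc : ∀ v, ContinuousOn (D v) {ζ | s₁ < ‖ζ‖ ∧ ‖ζ‖ < s₂} := by
    intro v
    refine ContinuousOn.sub (ContinuousOn.div (ContinuousOn.mul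
      (continuousOn_comp_log_normSq hh' hne) ?_) (hcc.pow _).continuousOn ?_)
      (ContinuousOn.div ((continuousOn_const.mul
        (continuousOn_comp_log_normSq hhc hne)).mul continuousOn_const)
        (hcc.pow _).continuousOn ?_)
    · refine continuous_ofReal.comp_continuousOn (ContinuousOn.div ?_ continuous_normSq.continuousOn
        fun ζ hζ => (map_ne_zero _).2 (hne ζ hζ))
      exact (continuous_const.mul ((continuous_re.mul continuous_const).add
        (continuous_im.mul continuous_const))).continuousOn
    · intro ζ hζ; exact pow_ne_zero _ ((map_ne_zero _).2 (hne ζ hζ))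
    · intro ζ hζ; exact pow_ne_zero _ ((map_ne_zero _).2 (hne ζ hζ))
  have hFc : ContinuousOn (fun ζ => h (Real.log (normSq ζ)) / conj ζ ^ (n + 1))
      {ζ | s₁ < ‖ζ‖ ∧ ‖ζ‖ < s₂} :=
    (continuousOn_comp_log_normSq hhc hne).div (hcc.pow _).continuousOn
      fun ζ hζ => pow_ne_zero _ ((map_ne_zero _).2 (hne ζ hζ))
  have hDz : ∀ v, ZeroMeansOn s₁ s₂ (D v) := fun v =>
    hF.directional_deriv hs₁ hFc (hDc v) fun ζ h1 h2 =>
      hasDerivAt_comp_log_normSq_div (hne ζ ⟨h1, h2⟩) n (hh _) v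
  intro a ρ h1 h2
  have hρ : 0 < ρ := by linarith [norm_nonneg a]
  have hmem : ∀ θ, circleMap a ρ θ ∈ {ζ : ℂ | s₁ < ‖ζ‖ ∧ ‖ζ‖ < s₂} := by
    intro θ
    have h3 := norm_circleMap_mem (a := a) hρ.le θ
    exact ⟨by linarith, by linarith⟩
  have hint : ∀ v, IntervalIntegrable (fun θ => D v (circleMap a ρ θ)) MeasureTheory.volume 0
      (2 * Real.pi) := fun v =>
    ((hDc v).comp_continuous (continuous_circleMap a ρ) hmem).intervalIntegrable _ _
  -- `∂/∂ζ = (∂₁ - I ∂_I) / 2` annihilates the powers of `conj ζ` and sends `h (log (ζ * conj ζ))`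
  -- to `h' / ζ = h' * exp (-log |ζ|²) * conj ζ`, which cancels one factor of the denominator.
  have hpt : ∀ ζ : ℂ, ζ ≠ 0 → h' (Real.log (normSq ζ)) * Real.exp (-Real.log (normSq ζ)) /
      conj ζ ^ n = 2⁻¹ * (D 1 ζ - I * D I ζ) := by
    intro ζ hζ
    have hcζ : conj ζ ≠ 0 := (map_ne_zero _).2 hζ
    rw [Real.exp_neg, Real.exp_log (normSq_pos.2 hζ)]
    have hc : conj ζ = ζ.re - ζ.im * I := by
      apply Complex.ext <;> simp
    have hNS : (normSq ζ : ℂ) = ζ * conj ζ := (mul_conj ζ).symm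
    simp only [hD, one_re, one_im, I_re, I_im, mul_one, mul_zero, add_zero, zero_add, map_one,
      conj_I]
    push_cast
    rw [hNS]
    field_simp
    linear_combination (norm := skip) (h' (Real.log (normSq ζ)) * 2 * conj ζ ^ (2 * n + 2)) * hc
    ring_nf
    simp only [I_sq]
    ring
  simp only
  rw [intervalIntegral.integral_congr (g := fun θ => 2⁻¹ * (D 1 (circleMap a ρ θ) -
    I * D I (circleMap a ρ θ))) fun θ _ => hpt _ (hne _ (hmem θ))]
  rw [intervalIntegral.integral_const_mul, intervalIntegral.integral_sub (hint 1)
    ((hint I).const_mul I), intervalIntegral.integral_const_mul, hDz 1 a ρ h1 h2, hDz I a ρ h1 h2]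
  simp

theorem intervalIntegral_swap_of_continuous {f : ℝ → ℝ → ℂ} (hf : Continuous (Function.uncurry f))
    (a b c d : ℝ) :
    ∫ x in a..b, ∫ y in c..d, f x y = ∫ y in c..d, ∫ x in a..b, f x y := by
  refine MeasureTheory.intervalIntegral_intervalIntegral_swap ?_
  exact (hf.continuousOn.integrableOn_compact (isCompact_uIcc.prod isCompact_uIcc)).mono_set
    (Set.prod_mono Set.uIoc_subset_uIcc Set.uIoc_subset_uIcc)

/-- Averages over dilations of a function with zero means have zero means. -/
theorem ZeroMeansOn.dilation_average {x₁ x₂ δ : ℝ} (hδ : 0 ≤ δ) {g : ℝ → ℂ} (hg : Continuous g)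
    {n : ℕ} (hF : ZeroMeansOn (Real.exp (x₁ / 2)) (Real.exp (x₂ / 2))
      fun ζ => g (Real.log (normSq ζ)) / conj ζ ^ n) :
    ZeroMeansOn (Real.exp (x₁ / 2)) (Real.exp ((x₂ - δ) / 2))
      fun ζ => (fun x => ∫ s in (0 : ℝ)..δ, g (x + s)) (Real.log (normSq ζ)) / conj ζ ^ n := by
  intro a ρ h1 h2
  have hρ : 0 < ρ := by linarith [norm_nonneg a, Real.exp_pos (x₁ / 2)]
  have hne : ∀ θ, circleMap a ρ θ ≠ 0 := by
    intro θ
    have h3 := (norm_circleMap_mem (a := a) hρ.le θ).1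
    exact norm_pos_iff.1 (by linarith [Real.exp_pos (x₁ / 2)])
  have hlog : Continuous fun θ => Real.log (normSq (circleMap a ρ θ)) :=
    (continuous_normSq.comp (continuous_circleMap a ρ)).log fun θ => (map_ne_zero _).2 (hne θ)
  have e1 : ∀ θ : ℝ, (fun x => ∫ s in (0 : ℝ)..δ, g (x + s))
      (Real.log (normSq (circleMap a ρ θ))) / conj (circleMap a ρ θ) ^ n =
      ∫ s in (0 : ℝ)..δ, g (Real.log (normSq (circleMap a ρ θ)) + s) /
        conj (circleMap a ρ θ) ^ n := by
    intro θ
    rw [intervalIntegral.integral_div]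
  simp only [e1]
  rw [intervalIntegral_swap_of_continuous]
  · rw [intervalIntegral.integral_congr (g := fun _ => (0 : ℂ)), intervalIntegral.integral_zero]
    intro s hs
    rw [Set.uIcc_of_le hδ] at hs
    -- Dilation by `exp (s / 2)` adds `s` to `log |ζ|²`. As `0 ≤ s ≤ δ`, the dilated circle stays in
    -- the larger annulus.
    set lam : ℝ := Real.exp (s / 2) with hlam
    have hl0 : 0 < lam := Real.exp_pos _
    have hl1 : 1 ≤ lam := Real.one_le_exp (by linarith [hs.1])
    have hmap : ∀ θ, circleMap (lam * a) (lam * ρ) θ = lam * circleMap a ρ θ := by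
      intro θ; simp [circleMap]; ring
    have hna : ‖(lam : ℂ) * a‖ = lam * ‖a‖ := by simp [abs_of_pos hl0]
    have hz := hF (lam * a) (lam * ρ) (by
        rw [hna]
        have : lam * (‖a‖ + Real.exp (x₁ / 2)) < lam * ρ := by gcongr
        nlinarith [Real.exp_pos (x₁ / 2)]) (by
        rw [hna]
        have h3 : Real.exp ((x₂ - δ) / 2) * lam ≤ Real.exp (x₂ / 2) := by
          rw [hlam, ← Real.exp_add]
          exact Real.exp_le_exp.2 (by linarith [hs.2])
        nlinarith)
    have hpt : ∀ θ : ℝ, g (Real.log (normSq (circleMap a ρ θ)) + s) /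
        conj (circleMap a ρ θ) ^ n = (lam : ℂ) ^ n *
        (g (Real.log (normSq (circleMap (lam * a) (lam * ρ) θ))) /
          conj (circleMap (lam * a) (lam * ρ) θ) ^ n) := by
      intro θ
      have hl : (lam : ℂ) ≠ 0 := by exact_mod_cast hl0.ne'
      rw [hmap, normSq_mul, Real.log_mul (by simpa using hl0.ne') ((map_ne_zero _).2 (hne θ)),
        normSq_ofReal, Real.log_mul hl0.ne' hl0.ne', hlam, Real.log_exp, ← hlam, map_mul,
        conj_ofReal, mul_pow, add_halves, add_comm s]
      field_simp
    simp only [hpt]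
    rw [intervalIntegral.integral_const_mul, hz, mul_zero]
  · refine Continuous.div ?_ ?_ ?_
    · exact hg.comp ((hlog.comp continuous_fst).add continuous_snd)
    · exact (continuous_conj.comp ((continuous_circleMap a ρ).comp continuous_fst)).pow n
    · rintro ⟨θ, s⟩
      exact pow_ne_zero _ ((map_ne_zero _).2 (hne θ))

/-! ### The radial factor is an exponential polynomial -/

/-- A function whose derivative on an interval is an exponential polynomial with positive
frequencies is an exponential polynomial there. -/
theorem exists_eq_sum_exp_of_deriv {x₁ x₂ : ℝ} {n : ℕ} {h h' : ℝ → ℂ}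
    (hh : ∀ x, HasDerivAt h (h' x) x) {c : Fin n → ℂ}
    (hc : ∀ x ∈ Set.Ioo x₁ x₂, h' x * Real.exp (-x) = ∑ j, c j * exp (j * x)) :
    ∃ d : Fin (n + 1) → ℂ, ∀ x ∈ Set.Ioo x₁ x₂, h x = ∑ j, d j * exp (j * x) := by
  -- Multiplying by `exp x` raises every frequency by one, so none is zero and termwise integration
  -- is possible. The integration constant becomes the coefficient of index 0.
  set S : ℝ → ℂ := fun x => ∑ j : Fin n, c j / (j + 1) * exp ((j + 1) * x) with hS
  have hSd : ∀ x : ℝ, HasDerivAt S (∑ j : Fin n, c j * exp ((j + 1) * x)) x := by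
    intro x
    refine HasDerivAt.fun_sum fun j _ => ?_
    have h1 : HasDerivAt (fun x : ℝ => ((j : ℂ) + 1) * x) (j + 1) x := by
      simpa using (hasDerivAt_id x).ofReal_comp.const_mul ((j : ℂ) + 1)
    have hj : (j : ℂ) + 1 ≠ 0 := by exact_mod_cast Nat.succ_ne_zero j
    refine (h1.cexp.const_mul (c j / (j + 1))).congr_deriv ?_
    field_simp
  have hd : ∀ x ∈ Set.Ioo x₁ x₂, HasDerivAt (fun x => h x - S x) 0 x := by
    intro x hx
    refine ((hh x).sub (hSd x)).congr_deriv ?_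
    have h1 : h' x = (h' x * Real.exp (-x)) * exp x := by
      push_cast
      rw [mul_assoc, ← Complex.exp_add]; simp
    rw [h1, hc x hx, Finset.sum_mul, sub_eq_zero]
    refine Finset.sum_congr rfl fun j _ => ?_
    rw [mul_assoc, ← Complex.exp_add]
    congr 2; ring
  obtain ⟨A, hA⟩ := isOpen_Ioo.exists_is_const_of_deriv_eq_zero isPreconnected_Ioo
    (fun x hx => (hd x hx).differentiableAt.differentiableWithinAt) (fun x hx => (hd x hx).deriv)
  refine ⟨Fin.cons A fun j => c j / (j + 1), fun x hx => ?_⟩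
  rw [Fin.sum_univ_succ]
  simp only [Fin.cons_zero, Fin.cons_succ, Fin.val_zero, Fin.val_succ]
  have := hA x hx
  simp only [hS] at this
  rw [← this]
  simp

/-- If `g(log |ζ|²) / conj ζ ^ n` has zero mean on all circles surrounding the origin in an annulus,
then `g(log |ζ|²)` is a polynomial in `|ζ|²` of degree less than `n`. -/
theorem ZeroMeansOn.eq_sum_exp (n : ℕ) : ∀ {x₁ x₂ : ℝ} {g : ℝ → ℂ}, Continuous g →
    ZeroMeansOn (Real.exp (x₁ / 2)) (Real.exp (x₂ / 2))
      (fun ζ => g (Real.log (normSq ζ)) / conj ζ ^ n) →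
    ∃ c : Fin n → ℂ, ∀ x ∈ Set.Ioo x₁ x₂, g x = ∑ j, c j * exp (j * x) := by
  induction n with
  | zero =>
    intro x₁ x₂ g hg hF
    refine ⟨0, fun x hx => ?_⟩
    -- The sum over `Fin 0` is empty, so the claim is `g x = 0`; on a circle centred at the origin
    -- the integrand is constant.
    have := hF 0 (Real.exp (x / 2)) (by simpa using div_lt_div_of_pos_right hx.1 two_pos)
      (by simpa using div_lt_div_of_pos_right hx.2 two_pos)
    have hn : ∀ θ, normSq (circleMap 0 (Real.exp (x / 2)) θ) = Real.exp x := by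
      intro θ
      rw [normSq_eq_norm_sq, norm_circleMap_zero, abs_of_pos (Real.exp_pos _), ← Real.exp_nat_mul]
      congr 1; push_cast; ring
    simp only [hn, Real.log_exp, pow_zero, div_one, intervalIntegral.integral_const] at this
    simpa [Real.pi_ne_zero] using this
  | succ n ih =>
    intro x₁ x₂ g hg hF
    set G : ℝ → ℂ := fun x => ∫ t in (0 : ℝ)..x, g t with hG
    have hGd : ∀ x, HasDerivAt G (g x) x := fun x =>
      intervalIntegral.integral_hasDerivAt_right (hg.intervalIntegrable _ _)
        (hg.stronglyMeasurableAtFilter _ _) hg.continuousAt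
    -- `g` is only continuous, but its averages over `[x, x + δ]` are `C¹`, so the Wirtinger
    -- derivative lowers the degree and induction applies.
    have hGδ : ∀ δ > 0, ∃ d : Fin (n + 1) → ℂ, ∀ x ∈ Set.Ioo x₁ (x₂ - δ),
        G (x + δ) - G x = ∑ j, d j * exp (j * x) := by
      intro δ hδ
      have hd : ∀ x, HasDerivAt (fun x => G (x + δ) - G x) (g (x + δ) - g x) x := fun x =>
        ((hGd (x + δ)).comp_add_const x δ).sub (hGd x)
      have havg := hF.dilation_average hδ.le hg
      have hrew : (fun x => ∫ s in (0 : ℝ)..δ, g (x + s)) = fun x => G (x + δ) - G x := by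
        ext x
        rw [intervalIntegral.integral_comp_add_left (fun t => g t), add_zero, hG]
        exact (intervalIntegral.integral_interval_sub_left (hg.intervalIntegrable _ _)
          (hg.intervalIntegrable _ _)).symm
      rw [hrew] at havg
      have hgc : Continuous fun x => g (x + δ) - g x := by fun_prop
      have hw := havg.wirtinger_deriv (Real.exp_pos _) hd hgc
      obtain ⟨c, hc⟩ := ih (g := fun x => (g (x + δ) - g x) * Real.exp (-x)) (by fun_prop) hw
      exact exists_eq_sum_exp_of_deriv hd hc
    choose! d hd using hGδ
    let e : Fin (n + 1) → (Set.Ioo x₁ x₂ → ℂ) := fun j x => exp (j * (x : ℝ))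
    let V : Submodule ℂ (Set.Ioo x₁ x₂ → ℂ) := Submodule.span ℂ (Set.range e)
    -- A finite-dimensional space is closed under pointwise limits, so `g`, the limit of the
    -- averages as `δ → 0`, is an exponential polynomial as well.
    have hV : IsClosed (V : Set (Set.Ioo x₁ x₂ → ℂ)) := by
      have : FiniteDimensional ℂ V := FiniteDimensional.span_of_finite ℂ (Set.finite_range e)
      exact V.closed_of_finiteDimensional
    have hmem : (fun x : Set.Ioo x₁ x₂ => g x) ∈ V := by
      refine hV.mem_of_tendsto (b := 𝓝[>] (0 : ℝ))
        (f := fun δ => δ⁻¹ • ∑ j, d δ j • e j) ?_ (Eventually.of_forall fun δ => ?_)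
      · rw [tendsto_pi_nhds]
        intro x
        have h1 := ((hasDerivAt_iff_tendsto_slope_zero.1 (hGd x)).mono_left
          (nhdsWithin_mono 0 (fun t ht => ne_of_gt ht) : 𝓝[>] (0 : ℝ) ≤ 𝓝[≠] 0))
        refine h1.congr' ?_
        have h2 : Set.Ioo (0 : ℝ) (x₂ - x) ∈ 𝓝[>] (0 : ℝ) :=
          Ioo_mem_nhdsGT (by linarith [x.2.2])
        filter_upwards [h2] with δ hδ
        rw [hd δ hδ.1 x ⟨x.2.1, by linarith [hδ.2]⟩]
        simp [e, Finset.sum_apply]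
      · show δ⁻¹ • ∑ j, d δ j • e j ∈ V
        rw [← Complex.coe_smul]
        exact V.smul_mem _ (V.sum_mem fun j _ => V.smul_mem _
          (Submodule.subset_span (Set.mem_range_self j)))
    obtain ⟨c, hc⟩ := (Submodule.mem_span_range_iff_exists_fun ℂ).1 hmem
    refine ⟨c, fun x hx => ?_⟩
    have := congrFun hc ⟨x, hx⟩
    simpa [e, Finset.sum_apply] using this.symm

/-! ### Rotation components -/

/-- The (unnormalised) projection of `f` to the functions `h` with `h(e^{iα}z) = e^{imα}h(z)`. -/
noncomputable def rotProj (f : ℂ → ℂ) (m : ℤ) (z : ℂ) : ℂ :=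
  ∫ α in -Real.pi..Real.pi, exp (-(m * α * I)) * f (exp (α * I) * z)

theorem continuous_rotProj {f : ℂ → ℂ} (hf : Continuous f) (m : ℤ) : Continuous (rotProj f m) :=
  intervalIntegral.continuous_parametric_intervalIntegral_of_continuous' (by fun_prop) _ _

theorem exp_int_mul_two_pi (m : ℤ) (α : ℝ) :
    exp (-(m * ((α + 2 * Real.pi : ℝ) : ℂ) * I)) = exp (-(m * α * I)) := by
  rw [← exp_periodic.sub_int_mul_eq (x := -(m * α * I)) m]
  congr 1; push_cast; ring

theorem exp_mul_I_two_pi (α : ℝ) : exp (((α + 2 * Real.pi : ℝ) : ℂ) * I) = exp (α * I) := by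
  rw [← exp_periodic (α * I)]
  congr 1; push_cast; ring

theorem rotProj_rotate (f : ℂ → ℂ) (m : ℤ) (β : ℝ) (z : ℂ) :
    rotProj f m (exp (β * I) * z) = exp (m * β * I) * rotProj f m z := by
  set G : ℝ → ℂ := fun α => exp (-(m * α * I)) * f (exp (α * I) * z) with hG
  have hper : Function.Periodic G (2 * Real.pi) := by
    intro α
    simp only [hG]
    rw [exp_int_mul_two_pi, exp_mul_I_two_pi]
  have h1 : ∀ α : ℝ, exp (-(m * α * I)) * f (exp (α * I) * (exp (β * I) * z)) =
      exp (m * β * I) * G (α + β) := by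
    intro α
    simp only [hG]
    rw [← mul_assoc, ← mul_assoc, ← Complex.exp_add, ← Complex.exp_add]
    congr 2
    · push_cast; ring
    · congr 2; push_cast; ring
  unfold rotProj
  simp only [h1]
  rw [intervalIntegral.integral_const_mul, intervalIntegral.integral_comp_add_right]
  have h2 := hper.intervalIntegral_add_eq (-Real.pi + β) (-Real.pi)
  rw [show -Real.pi + β + 2 * Real.pi = Real.pi + β by ring,
    show -Real.pi + 2 * Real.pi = Real.pi by ring] at h2
  rw [h2]

/-- Rotations about the origin permute the admissible circles; interchange the two integrals. -/
theorem ZeroMeansOn.rotProj {s₁ s₂ : ℝ} {f : ℂ → ℂ} (hf : Continuous f)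
    (hF : ZeroMeansOn s₁ s₂ f) (m : ℤ) : ZeroMeansOn s₁ s₂ (rotProj f m) := by
  intro a ρ h1 h2
  unfold _root_.rotProj
  rw [intervalIntegral_swap_of_continuous (by fun_prop)]
  rw [intervalIntegral.integral_congr (g := fun _ => (0 : ℂ)), intervalIntegral.integral_zero]
  intro α _
  simp only
  rw [intervalIntegral.integral_const_mul]
  have hmap : ∀ θ, exp (α * I) * circleMap a ρ θ = circleMap (exp (α * I) * a) ρ (θ + α) := by
    intro θ
    simp only [circleMap]
    push_cast
    rw [add_mul, Complex.exp_add]; ring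
  have hn : ‖exp (α * I) * a‖ = ‖a‖ := by simp [norm_exp_ofReal_mul_I]
  have h3 := hF (exp (α * I) * a) ρ (by rwa [hn]) (by rwa [hn])
  simp only [hmap]
  rw [intervalIntegral.integral_comp_add_right (fun θ => f (circleMap (exp (α * I) * a) ρ θ))]
  have h4 := ((periodic_circleMap (exp (α * I) * a) ρ).comp f).intervalIntegral_add_eq (0 + α) 0
  simp only [Function.comp_def] at h4
  rw [show 2 * Real.pi + α = 0 + α + 2 * Real.pi by ring, h4, zero_add, h3, mul_zero]

theorem ZeroMeansOn.comp_conj {s₁ s₂ : ℝ} {f : ℂ → ℂ} (hF : ZeroMeansOn s₁ s₂ f) :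
    ZeroMeansOn s₁ s₂ fun z => f (conj z) := by
  intro a ρ h1 h2
  have hmap : ∀ θ, conj (circleMap a ρ θ) = circleMap (conj a) ρ (-θ) := by
    intro θ
    simp [circleMap, ← exp_conj]
  have h3 := hF (conj a) ρ (by rwa [RCLike.norm_conj]) (by rwa [RCLike.norm_conj])
  simp only [hmap]
  rw [intervalIntegral.integral_comp_neg (fun θ => f (circleMap (conj a) ρ θ))]
  have h4 := ((periodic_circleMap (conj a) ρ).comp f).intervalIntegral_add_eq (-(2 * Real.pi)) 0
  simp only [Function.comp_def] at h4
  rw [neg_zero, show (0 : ℝ) = -(2 * Real.pi) + 2 * Real.pi by ring, h4, zero_add, h3]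

theorem rotProj_neg (f : ℂ → ℂ) (m : ℤ) (z : ℂ) :
    rotProj f (-m) z = rotProj (fun z => f (conj z)) m (conj z) := by
  unfold rotProj
  have := intervalIntegral.integral_comp_neg (a := -Real.pi) (b := Real.pi)
    (fun α : ℝ => exp (-((-m : ℤ) * α * I)) * f (exp (α * I) * z))
  rw [neg_neg] at this
  rw [← this]
  congr 1; ext α
  simp [← exp_conj]

theorem exp_nat_mul_log_normSq {ζ : ℂ} (hζ : ζ ≠ 0) (j : ℕ) :
    exp (j * (Real.log (normSq ζ) : ℝ)) = (ζ * conj ζ) ^ j := by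
  rw [Complex.exp_nat_mul, ← ofReal_exp, Real.exp_log (normSq_pos.2 hζ), mul_conj]

/-- The structure of the rotation components of functions with zero means. -/
theorem ZeroMeansOn.rotProj_eq_sum {r₁ r₂ : ℝ} (hr₁ : 0 < r₁) (hr₂ : 0 < r₂) {f : ℂ → ℂ}
    (hf : Continuous f) (hF : ZeroMeansOn r₁ r₂ f) (n : ℕ) :
    ∃ c : Fin n → ℂ, ∀ ζ : ℂ, r₁ < ‖ζ‖ → ‖ζ‖ < r₂ →
      _root_.rotProj f n ζ = ∑ j, c j * ζ ^ (j : ℕ) * (conj ζ)⁻¹ ^ (n - j) := by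
  -- By equivariance the component is determined by its values on the positive axis; the power of
  -- the radius makes up for writing the angular factor as `1 / conj ζ ^ n`.
  set g : ℝ → ℂ := fun x => _root_.rotProj f n (Real.exp (x / 2)) * Real.exp (x / 2) ^ n with hg
  have hgc : Continuous g :=
    ((continuous_rotProj hf n).comp (by fun_prop)).mul (by fun_prop)
  have hexp : ∀ {r : ℝ}, 0 < r → Real.exp (2 * Real.log r / 2) = r := fun hr => by
    rw [mul_div_cancel_left₀ _ two_ne_zero, Real.exp_log hr]
  have hgf : ∀ ζ : ℂ, ζ ≠ 0 → _root_.rotProj f n ζ = g (Real.log (normSq ζ)) / conj ζ ^ n := by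
    intro ζ hζ
    have hn : 0 < ‖ζ‖ := norm_pos_iff.2 hζ
    have h1 : Real.exp (Real.log (normSq ζ) / 2) = ‖ζ‖ := by
      rw [normSq_eq_norm_sq, Real.log_pow]; exact_mod_cast hexp hn
    have h2 : ζ = exp (arg ζ * I) * (‖ζ‖ : ℂ) := by
      rw [mul_comm]; exact (norm_mul_exp_arg_mul_I ζ).symm
    have h3 : conj ζ * exp (arg ζ * I) = ‖ζ‖ := by
      have : exp (arg ζ * I) = ζ / ‖ζ‖ := by
        rw [eq_div_iff (by exact_mod_cast hn.ne')]; exact h2.symm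
      rw [this, ← mul_div_assoc, conj_mul', sq, mul_div_assoc, div_self (by exact_mod_cast hn.ne'),
        mul_one]
    have hcζ : conj ζ ≠ 0 := (map_ne_zero _).2 hζ
    simp only [hg]
    rw [h1, eq_div_iff (pow_ne_zero _ hcζ), ← h3]
    have h5 := rotProj_rotate f n (arg ζ) ‖ζ‖
    rw [← h2, Int.cast_natCast, mul_assoc, Complex.exp_nat_mul] at h5
    rw [h3, h5, ← h3, mul_pow]
    ring
  have hz : ZeroMeansOn (Real.exp (2 * Real.log r₁ / 2)) (Real.exp (2 * Real.log r₂ / 2))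
      (fun ζ => g (Real.log (normSq ζ)) / conj ζ ^ n) := by
    rw [hexp hr₁, hexp hr₂]
    intro a ρ h1 h2
    have hρ : 0 < ρ := by linarith [norm_nonneg a]
    rw [← hF.rotProj hf n a ρ h1 h2]
    refine intervalIntegral.integral_congr fun θ _ => (hgf _ ?_).symm
    have h3 := (norm_circleMap_mem (a := a) hρ.le θ).1
    exact norm_pos_iff.1 (by linarith)
  obtain ⟨c, hc⟩ := hz.eq_sum_exp n hgc
  refine ⟨c, fun ζ h1 h2 => ?_⟩
  have hn : 0 < ‖ζ‖ := hr₁.trans h1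
  have hζ : ζ ≠ 0 := norm_pos_iff.1 hn
  have hcζ : conj ζ ≠ 0 := (map_ne_zero _).2 hζ
  rw [hgf ζ hζ, hc _ ?_, Finset.sum_div]
  · refine Finset.sum_congr rfl fun j _ => ?_
    rw [exp_nat_mul_log_normSq hζ, mul_pow, inv_pow, mul_assoc, mul_div_assoc, mul_div_assoc]
    congr 2
    have hpow : conj ζ ^ n = conj ζ ^ (n - (j : ℕ)) * conj ζ ^ (j : ℕ) := by
      rw [← pow_add, Nat.sub_add_cancel j.2.le]
    rw [div_eq_iff (pow_ne_zero _ hcζ), hpow, inv_mul_cancel_left₀ (pow_ne_zero _ hcζ)]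
  · rw [normSq_eq_norm_sq, Real.log_pow]
    push_cast
    have e1 := Real.log_lt_log hr₁ h1
    have e2 := Real.log_lt_log hn h2
    exact ⟨by linarith, by linarith⟩

/-! ### Entire lifts and approximation by trigonometric kernels -/

/-- `h` agrees on `S` with a sum of (restrictions to `w = conj z` of) a function of `z, w⁻¹` and a
function of `conj z, conj w⁻¹`, both entire and vanishing at `w = ∞`. -/
def HasEntireLift (S : Set ℂ) (h : ℂ → ℂ) : Prop :=
  ∃ p q : ℂ × ℂ → ℂ, (∀ k : ℕ, ContDiff ℂ k p) ∧ (∀ k : ℕ, ContDiff ℂ k q) ∧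
    (∀ z, p (z, 0) = 0) ∧ (∀ z, q (z, 0) = 0) ∧
    ∀ z ∈ S, h z = p (z, (conj z)⁻¹) + q (conj z, z⁻¹)

theorem HasEntireLift.add {S : Set ℂ} {h₁ h₂ : ℂ → ℂ} (H₁ : HasEntireLift S h₁)
    (H₂ : HasEntireLift S h₂) : HasEntireLift S fun z => h₁ z + h₂ z := by
  obtain ⟨p₁, q₁, a₁, b₁, c₁, d₁, e₁⟩ := H₁
  obtain ⟨p₂, q₂, a₂, b₂, c₂, d₂, e₂⟩ := H₂
  refine ⟨p₁ + p₂, q₁ + q₂, fun k => (a₁ k).add (a₂ k), fun k => (b₁ k).add (b₂ k),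
    by simp [c₁, c₂], by simp [d₁, d₂], fun z hz => ?_⟩
  simp only [Pi.add_apply, e₁ z hz, e₂ z hz]; ring

theorem HasEntireLift.const_mul {S : Set ℂ} {h : ℂ → ℂ} (H : HasEntireLift S h) (c : ℂ) :
    HasEntireLift S fun z => c * h z := by
  obtain ⟨p, q, a, b, c', d, e⟩ := H
  refine ⟨fun x => c * p x, fun x => c * q x, fun k => contDiff_const.mul (a k),
    fun k => contDiff_const.mul (b k), by simp [c'], by simp [d], fun z hz => ?_⟩
  simp only [e z hz]; ring

theorem ZeroMeansOn.hasEntireLift_rotProj {r₁ r₂ : ℝ} (hr₁ : 0 < r₁) (hr₂ : 0 < r₂) {f : ℂ → ℂ}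
    (hf : Continuous f) (hF : ZeroMeansOn r₁ r₂ f) (m : ℤ) :
    HasEntireLift {ζ | r₁ < ‖ζ‖ ∧ ‖ζ‖ < r₂} (_root_.rotProj f m) := by
  obtain ⟨n, rfl | rfl⟩ := m.eq_nat_or_neg
  · obtain ⟨c, hc⟩ := hF.rotProj_eq_sum hr₁ hr₂ hf n
    refine ⟨fun x => ∑ j : Fin n, c j * x.1 ^ (j : ℕ) * x.2 ^ (n - j), fun _ => 0,
      fun k => by fun_prop, fun k => contDiff_const, fun z => ?_, fun _ => rfl, fun z hz => ?_⟩
    · exact Finset.sum_eq_zero fun j _ => by simp [Nat.sub_ne_zero_of_lt j.2]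
    · simp only [hc z hz.1 hz.2, add_zero]
  · obtain ⟨c, hc⟩ := ZeroMeansOn.rotProj_eq_sum (f := fun z => f (conj z)) hr₁ hr₂
      (hf.comp continuous_conj) hF.comp_conj n
    refine ⟨fun _ => 0, fun x => ∑ j : Fin n, c j * x.1 ^ (j : ℕ) * x.2 ^ (n - j),
      fun k => contDiff_const, fun k => by fun_prop, fun _ => rfl, fun z => ?_, fun z hz => ?_⟩
    · exact Finset.sum_eq_zero fun j _ => by simp [Nat.sub_ne_zero_of_lt j.2]
    · rw [rotProj_neg, hc (conj z) (by simpa using hz.1) (by simpa using hz.2)]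
      simp

/-- Averages of rotations against powers of the kernel `(1 + cos θ) / 2`. -/
theorem ZeroMeansOn.hasEntireLift_kernel {r₁ r₂ : ℝ} (hr₁ : 0 < r₁) (hr₂ : 0 < r₂) {f : ℂ → ℂ}
    (hf : Continuous f) (hF : ZeroMeansOn r₁ r₂ f) (N : ℕ) : ∀ m : ℤ,
    HasEntireLift {ζ | r₁ < ‖ζ‖ ∧ ‖ζ‖ < r₂} fun z => ∫ α in -Real.pi..Real.pi,
      (((1 + Real.cos α) / 2 : ℝ) : ℂ) ^ N * (exp (-(m * α * I)) * f (exp (α * I) * z)) := by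
  induction N with
  | zero =>
    intro m
    have := hF.hasEntireLift_rotProj hr₁ hr₂ hf m
    unfold _root_.rotProj at this
    simpa using this
  | succ N ih =>
    intro m
    have key := (((ih m).const_mul (1 / 2)).add ((ih (m + 1)).const_mul (1 / 4))).add
      ((ih (m - 1)).const_mul (1 / 4))
    convert key using 2 with z
    have hint : ∀ m : ℤ, IntervalIntegrable (fun α : ℝ => (((1 + Real.cos α) / 2 : ℝ) : ℂ) ^ N *
        (exp (-(m * α * I)) * f (exp (α * I) * z))) MeasureTheory.volume (-Real.pi) Real.pi :=
      fun m => Continuous.intervalIntegrable (by fun_prop) _ _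
    rw [← intervalIntegral.integral_const_mul, ← intervalIntegral.integral_const_mul,
      ← intervalIntegral.integral_const_mul,
      ← intervalIntegral.integral_add ((hint m).const_mul _) ((hint _).const_mul _),
      ← intervalIntegral.integral_add (((hint m).const_mul _).add ((hint _).const_mul _))
        ((hint _).const_mul _)]
    congr 1; ext α
    -- The factor `(1 + cos α) / 2` is `1/2` plus a quarter of `exp (α * I) + exp (-α * I)`, so it
    -- only mixes the frequencies `m` and `m ± 1`.
    have e1 : exp (-((m + 1 : ℤ) * α * I)) = exp (-(m * α * I)) * exp (-α * I) := by
      rw [← Complex.exp_add]; congr 1; push_cast; ring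
    have e2 : exp (-((m - 1 : ℤ) * α * I)) = exp (-(m * α * I)) * exp (α * I) := by
      rw [← Complex.exp_add]; congr 1; push_cast; ring
    have e3 : (((1 + Real.cos α) / 2 : ℝ) : ℂ) =
        1 / 2 + (exp (-α * I) + exp (α * I)) / 4 := by
      push_cast [Complex.cos]; ring
    rw [e1, e2, pow_succ, e3]
    ring

theorem isCompact_closedAnnulus (r₁ r₂ : ℝ) : IsCompact (closedAnnulus r₁ r₂) := by
  refine isCompact_of_isClosed_isBounded ?_ ?_
  · exact (isClosed_le continuous_const continuous_norm).inter
      (isClosed_le continuous_norm continuous_const)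
  · exact (isBounded_closedBall (x := (0 : ℂ)) (r := r₂)).subset
      fun ζ hζ => mem_closedBall_zero_iff.2 hζ.2

/-- A continuous function is the uniform limit on an annulus of its averages over rotations against
the normalised powers of `(1 + cos θ) / 2`. -/
theorem exists_norm_sub_kernel_le {f : ℂ → ℂ} (hf : Continuous f) (r₁ r₂ : ℝ) {ε : ℝ}
    (hε : 0 < ε) : ∃ (N : ℕ) (C : ℂ), ∀ z ∈ closedAnnulus r₁ r₂,
      ‖f z - C * ∫ α in -Real.pi..Real.pi,
        (((1 + Real.cos α) / 2 : ℝ) : ℂ) ^ N * f (exp (α * I) * z)‖ ≤ ε := by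
  have : CompactSpace (closedAnnulus r₁ r₂) :=
    isCompact_iff_compactSpace.1 (isCompact_closedAnnulus r₁ r₂)
  -- With values in the space of continuous functions on the annulus, the peak-kernel theorem yields
  -- convergence uniform in `z`.
  let Φ : C(ℝ, C(closedAnnulus r₁ r₂, ℂ)) := ContinuousMap.curry
    ⟨fun x : ℝ × closedAnnulus r₁ r₂ => f (exp (x.1 * I) * x.2), by fun_prop⟩
  have hpi := Real.pi_pos
  have hcos : ∀ y ∈ Set.Icc (-Real.pi) Real.pi, y ≠ 0 →
      (1 + Real.cos y) / 2 < (1 + Real.cos 0) / 2 := by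
    intro y hy hy0
    have : Real.cos |y| < Real.cos 0 := Real.cos_lt_cos_of_nonneg_of_le_pi le_rfl
      (abs_le.2 hy) (abs_pos.2 hy0)
    rw [Real.cos_abs] at this
    linarith
  have hlim := tendsto_setIntegral_pow_smul_of_unique_maximum_of_isCompact_of_continuousOn
    (μ := MeasureTheory.volume) (s := Set.Icc (-Real.pi) Real.pi) (x₀ := (0 : ℝ))
    (c := fun θ => (1 + Real.cos θ) / 2) (g := Φ) isCompact_Icc (by fun_prop) hcos
    (fun x _ => by linarith [Real.neg_one_le_cos x]) (by norm_num)
    (by rw [interior_Icc, closure_Ioo (by linarith)]; exact ⟨by linarith, by linarith⟩)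
    Φ.continuous.continuousOn
  obtain ⟨N, hN⟩ := (Metric.tendsto_atTop.1 hlim ε hε)
  refine ⟨N, ((∫ x in Set.Icc (-Real.pi) Real.pi, ((1 + Real.cos x) / 2) ^ N)⁻¹ : ℝ),
    fun z hz => ?_⟩
  have h1 := (ContinuousMap.dist_apply_le_dist (⟨z, hz⟩ : closedAnnulus r₁ r₂)).trans
    (hN N le_rfl).le
  rw [dist_comm, dist_eq_norm] at h1
  refine le_trans (le_of_eq ?_) h1
  have hint : MeasureTheory.IntegrableOn (fun x : ℝ => ((1 + Real.cos x) / 2) ^ N • Φ x)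
      (Set.Icc (-Real.pi) Real.pi) :=
    Continuous.integrableOn_Icc (by fun_prop)
  rw [ContinuousMap.smul_apply, ContinuousMap.integral_apply hint]
  simp only [MeasureTheory.integral_Icc_eq_integral_Ioc,
    ← intervalIntegral.integral_of_le (show -Real.pi ≤ Real.pi by linarith)]
  simp [Φ]

/-! ### Geometry of the annulus and of `Ω⁺`, `Ω⁻` -/

theorem interior_closedAnnulus_subset {r₁ r₂ : ℝ} (hr₁ : 0 < r₁) (hr₂ : 0 < r₂) :
    interior (closedAnnulus r₁ r₂) ⊆ {ζ | r₁ < ‖ζ‖ ∧ ‖ζ‖ < r₂} := by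
  have h1 : closedAnnulus r₁ r₂ ⊆ (ball (0 : ℂ) r₁)ᶜ := fun ζ hζ => by
    simpa using hζ.1
  have h2 : closedAnnulus r₁ r₂ ⊆ closedBall (0 : ℂ) r₂ := fun ζ hζ =>
    mem_closedBall_zero_iff.2 hζ.2
  intro ζ hζ
  have h3 := interior_mono h1 hζ
  have h4 := interior_mono h2 hζ
  rw [interior_compl, closure_ball _ hr₁.ne'] at h3
  rw [interior_closedBall _ hr₂.ne'] at h4
  exact ⟨by simpa using h3, by simpa using h4⟩

theorem isOpen_openAnnulus (r₁ r₂ : ℝ) : IsOpen {ζ : ℂ | r₁ < ‖ζ‖ ∧ ‖ζ‖ < r₂} :=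
  (isOpen_lt continuous_const continuous_norm).inter (isOpen_lt continuous_norm continuous_const)

theorem subset_interior_closedAnnulus (r₁ r₂ : ℝ) :
    {ζ : ℂ | r₁ < ‖ζ‖ ∧ ‖ζ‖ < r₂} ⊆ interior (closedAnnulus r₁ r₂) :=
  interior_maximal (fun _ h => ⟨h.1.le, h.2.le⟩) (isOpen_openAnnulus r₁ r₂)

theorem closedAnnulus_subset_closure {r₁ r₂ : ℝ} (hr₁ : 0 < r₁) (hr : r₁ < r₂) :
    closedAnnulus r₁ r₂ ⊆ closure {ζ : ℂ | r₁ < ‖ζ‖ ∧ ‖ζ‖ < r₂} := by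
  intro z hz
  have hz0 : 0 < ‖z‖ := hr₁.trans_le hz.1
  set m := (r₁ + r₂) / 2 with hm
  have hlim : Tendsto (fun t : ℝ => ((1 + t * (m / ‖z‖ - 1) : ℝ) : ℂ) * z) (𝓝[>] 0) (𝓝 z) := by
    refine tendsto_nhdsWithin_of_tendsto_nhds ?_
    have : Continuous fun t : ℝ => ((1 + t * (m / ‖z‖ - 1) : ℝ) : ℂ) * z := by fun_prop
    simpa using this.tendsto 0
  refine mem_closure_of_tendsto hlim ?_
  filter_upwards [Ioo_mem_nhdsGT (zero_lt_one' ℝ)] with t ht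
  have h1 : (1 + t * (m / ‖z‖ - 1)) * ‖z‖ = (1 - t) * ‖z‖ + t * m := by
    field_simp; ring
  have h2 : 0 ≤ 1 + t * (m / ‖z‖ - 1) := by
    have : 0 < m / ‖z‖ := div_pos (by linarith) hz0
    nlinarith [ht.1, ht.2]
  have h3 : ‖((1 + t * (m / ‖z‖ - 1) : ℝ) : ℂ) * z‖ = (1 - t) * ‖z‖ + t * m := by
    rw [norm_mul, Complex.norm_real, Real.norm_of_nonneg h2, h1]
  show r₁ < _ ∧ _ < r₂
  rw [h3]
  have h4 := hz.1
  have h5 := hz.2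
  have ht0 := ht.1
  have ht1 : 0 < 1 - t := by linarith [ht.2]
  constructor <;> nlinarith

theorem sphere_subset_openAnnulus {r₁ r₂ : ℝ} {a : ℂ} {ρ : ℝ} (h1 : ‖a‖ + r₁ < ρ)
    (h2 : ρ + ‖a‖ < r₂) : sphere a ρ ⊆ {ζ : ℂ | r₁ < ‖ζ‖ ∧ ‖ζ‖ < r₂} := by
  intro ζ hζ
  have h3 : ‖ζ - a‖ = ρ := mem_sphere_iff_norm.1 hζ
  have h4 := norm_sub_le ζ a
  have h5 := norm_add_le (ζ - a) a
  rw [sub_add_cancel] at h5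
  constructor <;> linarith

theorem isSurroundingCircle_interior_iff {r₁ r₂ : ℝ} (hr₁ : 0 < r₁) (hr₂ : 0 < r₂) {a : ℂ}
    {ρ : ℝ} : IsSurroundingCircle (interior (closedAnnulus r₁ r₂)) a ρ ↔
      ‖a‖ + r₁ < ρ ∧ ρ + ‖a‖ < r₂ := by
  constructor
  · rintro ⟨hρ, hsub, h0⟩
    have haρ : ‖a‖ < ρ := by simpa using h0
    obtain ⟨u, hu, hau⟩ : ∃ u : ℂ, ‖u‖ = 1 ∧ a = ‖a‖ * u := by
      rcases eq_or_ne a 0 with rfl | ha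
      · exact ⟨1, by simp, by simp⟩
      · refine ⟨a / ‖a‖, by simp [ha], ?_⟩
        rw [mul_div_cancel₀]; simpa using ha
    -- The points of the circle farthest from and nearest to the origin lie on the diameter through
    -- the origin.
    have h1 := (interior_closedAnnulus_subset hr₁ hr₂
      (hsub (show a + ρ * u ∈ sphere a ρ by simp [hu, abs_of_pos hρ]))).2
    have h2 := (interior_closedAnnulus_subset hr₁ hr₂
      (hsub (show a - ρ * u ∈ sphere a ρ by simp [hu, abs_of_pos hρ]))).1
    have e1 : ‖a + ρ * u‖ = ρ + ‖a‖ := by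
      have : a + ρ * u = ((ρ + ‖a‖ : ℝ) : ℂ) * u := by
        conv_lhs => rw [hau]
        push_cast; ring
      rw [this, norm_mul, hu, Complex.norm_real, mul_one, Real.norm_of_nonneg (by positivity)]
    have e2 : ‖a - ρ * u‖ = ρ - ‖a‖ := by
      have : a - ρ * u = ((‖a‖ - ρ : ℝ) : ℂ) * u := by
        conv_lhs => rw [hau]
        push_cast; ring
      rw [this, norm_mul, hu, Complex.norm_real, mul_one, Real.norm_of_nonpos (by linarith)]
      ring
    rw [e1] at h1
    rw [e2] at h2
    exact ⟨by linarith, h1⟩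
  · rintro ⟨h1, h2⟩
    have hρ : 0 < ρ := by linarith [norm_nonneg a]
    exact ⟨hρ, (sphere_subset_openAnnulus h1 h2).trans (subset_interior_closedAnnulus r₁ r₂),
      by simp; linarith⟩

theorem mem_omegaPlus_iff {r₁ r₂ : ℝ} (hr₁ : 0 < r₁) (hr₂ : 0 < r₂) {x : ℂ × ℂ} :
    x ∈ omegaPlus (closedAnnulus r₁ r₂) ↔
      ∃ a ρ, (‖a‖ + r₁ < ρ ∧ ρ + ‖a‖ < r₂) ∧ x ∈ lambdaPlus a ρ := by
  unfold omegaPlus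
  simp only [Set.mem_ofPred_eq, isSurroundingCircle_interior_iff hr₁ hr₂]

theorem mem_omegaMinus_iff {r₁ r₂ : ℝ} (hr₁ : 0 < r₁) (hr₂ : 0 < r₂) {x : ℂ × ℂ} :
    x ∈ omegaMinus (closedAnnulus r₁ r₂) ↔
      ∃ a ρ, (‖a‖ + r₁ < ρ ∧ ρ + ‖a‖ < r₂) ∧ x ∈ lambdaMinus a ρ := by
  unfold omegaMinus
  simp only [Set.mem_ofPred_eq, isSurroundingCircle_interior_iff hr₁ hr₂]

theorem conj_mem_omegaPlus {r₁ r₂ : ℝ} (hr₁ : 0 < r₁) (hr₂ : 0 < r₂) {x : ℂ × ℂ}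
    (hx : x ∈ omegaPlus (closedAnnulus r₁ r₂)) :
    (conj x.1, conj x.2) ∈ omegaPlus (closedAnnulus r₁ r₂) := by
  rw [mem_omegaPlus_iff hr₁ hr₂] at hx ⊢
  obtain ⟨a, ρ, h, h1, h2, h3⟩ := hx
  refine ⟨conj a, ρ, by simpa using h, ?_, ?_, ?_⟩
  · simp only [← map_sub, ← map_mul, h1]; simp
  · simpa only [← map_sub, RCLike.norm_conj] using h2
  · simpa only [← map_sub, RCLike.norm_conj] using h3

/-- On a leaf `‖z - a‖ * ‖w - conj a‖ = ρ ^ 2`, so exchanging the coordinates turns the outer leaf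
of `a` into the inner leaf of `conj a`. -/
theorem swap_mem_omegaPlus {r₁ r₂ : ℝ} (hr₁ : 0 < r₁) (hr₂ : 0 < r₂) {x : ℂ × ℂ}
    (hx : x ∈ omegaMinus (closedAnnulus r₁ r₂)) :
    (x.2, x.1) ∈ omegaPlus (closedAnnulus r₁ r₂) := by
  rw [mem_omegaPlus_iff hr₁ hr₂]
  rw [mem_omegaMinus_iff hr₁ hr₂] at hx
  obtain ⟨a, ρ, h, h1, h2⟩ := hx
  have hρ : 0 < ρ := by linarith [norm_nonneg a, h.1]
  have hn : ‖x.1 - a‖ * ‖x.2 - conj a‖ = ρ ^ 2 := by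
    rw [← norm_mul, h1]; simp
  have hpos : 0 < ‖x.2 - conj a‖ := by
    by_contra hcon
    have : ‖x.2 - conj a‖ = 0 := le_antisymm (not_lt.1 hcon) (norm_nonneg _)
    rw [this] at hn
    nlinarith
  refine ⟨conj a, ρ, by simpa using h, ?_, hpos, ?_⟩
  · simp only [conj_conj]; rw [mul_comm]; exact h1
  · show ‖x.2 - conj a‖ < ρ
    nlinarith

/-- On an inner leaf `‖w - conj a‖ > ρ > ‖a‖ + r₁`. This keeps `w⁻¹` regular on `Ω⁺` and up to its
closure. -/
theorem lt_norm_snd_of_mem_omegaPlus {r₁ r₂ : ℝ} (hr₁ : 0 < r₁) (hr₂ : 0 < r₂) {x : ℂ × ℂ}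
    (hx : x ∈ omegaPlus (closedAnnulus r₁ r₂)) : r₁ < ‖x.2‖ := by
  rw [mem_omegaPlus_iff hr₁ hr₂] at hx
  obtain ⟨a, ρ, h, h1, h2, h3⟩ := hx
  have hρ : 0 < ρ := by linarith [norm_nonneg a, h.1]
  have hn : ‖x.1 - a‖ * ‖x.2 - conj a‖ = ρ ^ 2 := by
    rw [← norm_mul, h1]; simp
  have h4 : ρ < ‖x.2 - conj a‖ := by nlinarith
  have h5 := norm_sub_le x.2 (conj a)
  rw [RCLike.norm_conj] at h5
  linarith [h.1]

theorem le_norm_snd_of_mem_closure {r₁ r₂ : ℝ} (hr₁ : 0 < r₁) (hr₂ : 0 < r₂) {x : ℂ × ℂ}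
    (hx : x ∈ closure (omegaPlus (closedAnnulus r₁ r₂))) : r₁ ≤ ‖x.2‖ :=
  closure_minimal (t := {x : ℂ × ℂ | r₁ ≤ ‖x.2‖})
    (fun _ h => (lt_norm_snd_of_mem_omegaPlus hr₁ hr₂ h).le)
    (isClosed_le continuous_const (by fun_prop)) hx

theorem conjLift_subset_closure {r₁ r₂ : ℝ} (hr₁ : 0 < r₁) (hr : r₁ < r₂) :
    conjLift (closedAnnulus r₁ r₂) ⊆ closure (omegaPlus (closedAnnulus r₁ r₂)) := by
  have hr₂ := hr₁.trans hr
  have hopen : ∀ z ∈ {ζ : ℂ | r₁ < ‖ζ‖ ∧ ‖ζ‖ < r₂},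
      (z, conj z) ∈ closure (omegaPlus (closedAnnulus r₁ r₂)) := by
    intro z hz
    have hz0 : 0 < ‖z‖ := hr₁.trans hz.1
    -- For `0 < t < 1` these points lie on the leaf of the circle of radius `‖z‖` about the origin.
    have hlim : Tendsto (fun t : ℝ => ((t : ℂ) * z, ((t⁻¹ : ℝ) : ℂ) * conj z)) (𝓝[<] 1)
        (𝓝 (z, conj z)) := by
      have h1 : Tendsto (fun t : ℝ => (t : ℂ) * z) (𝓝[<] 1) (𝓝 z) := by
        refine tendsto_nhdsWithin_of_tendsto_nhds ?_
        have : Continuous fun t : ℝ => (t : ℂ) * z := by fun_prop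
        simpa using this.tendsto 1
      have h2 : Tendsto (fun t : ℝ => ((t⁻¹ : ℝ) : ℂ) * conj z) (𝓝[<] 1) (𝓝 (conj z)) := by
        refine tendsto_nhdsWithin_of_tendsto_nhds ?_
        have : ContinuousAt (fun t : ℝ => ((t⁻¹ : ℝ) : ℂ) * conj z) 1 :=
          (continuous_ofReal.continuousAt.comp (continuousAt_inv₀ one_ne_zero)).mul
            continuousAt_const
        simpa [ContinuousAt] using this
      exact h1.prodMk_nhds h2
    refine mem_closure_of_tendsto hlim ?_
    filter_upwards [Ioo_mem_nhdsLT (zero_lt_one' ℝ)] with t ht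
    rw [mem_omegaPlus_iff hr₁ hr₂]
    have htc : (t : ℂ) ≠ 0 := by exact_mod_cast ht.1.ne'
    have hn : ‖(t : ℂ) * z - 0‖ = t * ‖z‖ := by simp [abs_of_pos ht.1]
    refine ⟨0, ‖z‖, by simpa using hz, ?_, ?_, ?_⟩
    · simp only [sub_zero, map_zero]
      rw [← mul_conj']; push_cast; field_simp
    · simp only [hn]; exact mul_pos ht.1 hz0
    · simp only [hn]; nlinarith [ht.2]
  rintro ⟨z, w⟩ ⟨hz, hw⟩
  simp only at hz hw
  subst hw
  have hc : Continuous fun z : ℂ => (z, conj z) := by fun_prop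
  exact closure_minimal (t := (fun z : ℂ => (z, conj z)) ⁻¹' closure (omegaPlus _)) hopen
    (isClosed_closure.preimage hc) (closedAnnulus_subset_closure hr₁ hr hz)

/-- Near a point of `Λ⁺_{a,ρ}`, the nearby leaves can be chosen with constant ratio
`‖z - a‖ / ρ`. -/
theorem exists_ball_lambdaPlus {r₁ r₂ : ℝ} (hr₁ : 0 < r₁) (hr₂ : 0 < r₂) {x : ℂ × ℂ}
    (hx : x ∈ omegaPlus (closedAnnulus r₁ r₂)) :
    ∃ κ ∈ Set.Ioo (0 : ℝ) 1, ∃ r > 0, ∀ y ∈ ball x r,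
      ∃ a ρ, (‖a‖ + r₁ < ρ ∧ ρ + ‖a‖ < r₂) ∧ y ∈ lambdaPlus a ρ ∧ ‖y.1 - a‖ = κ * ρ := by
  rw [mem_omegaPlus_iff hr₁ hr₂] at hx
  obtain ⟨a₀, ρ₀, h, h1, h2, h3⟩ := hx
  have hρ₀ : 0 < ρ₀ := by linarith [norm_nonneg a₀, h.1]
  obtain ⟨κ, hκ⟩ : ∃ κ, κ = ‖x.1 - a₀‖ / ρ₀ := ⟨_, rfl⟩
  have hκ0 : 0 < κ := by rw [hκ]; positivity
  have hκ1 : κ < 1 := by rw [hκ, div_lt_one hρ₀]; exact h3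
  have hκρ : ‖x.1 - a₀‖ = κ * ρ₀ := by rw [hκ]; field_simp
  have ht1 : 0 < 1 - κ ^ 2 := by nlinarith
  have htc : (1 : ℂ) - (κ : ℂ) ^ 2 ≠ 0 := by exact_mod_cast ht1.ne'
  -- If `‖z - a‖ = κ * ρ`, the leaf equation becomes `z - a = κ² (conj w - a)`. Solving for `a` and
  -- `ρ` gives `A` and `R`, which are continuous in the point, so admissibility of the circle
  -- persists nearby.
  set A : ℂ × ℂ → ℂ := fun y => (y.1 - (κ : ℂ) ^ 2 * conj y.2) / (1 - (κ : ℂ) ^ 2) with hA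
  set R : ℂ × ℂ → ℝ := fun y => κ * ‖conj y.2 - y.1‖ / (1 - κ ^ 2) with hR
  have hAc : Continuous A := by
    refine Continuous.div_const ?_ _
    exact continuous_fst.sub (continuous_const.mul (continuous_conj.comp continuous_snd))
  have hRc : Continuous R := by
    refine Continuous.div_const ?_ _
    exact continuous_const.mul ((continuous_conj.comp continuous_snd).sub continuous_fst).norm
  have hw : conj x.2 - x.1 = (x.1 - a₀) * ((1 - (κ : ℂ) ^ 2) / (κ : ℂ) ^ 2) := by
    have hκc : (κ : ℂ) ≠ 0 := by exact_mod_cast hκ0.ne'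
    have e1 : conj (x.1 - a₀) * (conj x.2 - a₀) = (ρ₀ : ℂ) ^ 2 := by
      have := congrArg conj h1
      simpa using this
    have e2 : (x.1 - a₀) * conj (x.1 - a₀) = (κ : ℂ) ^ 2 * (ρ₀ : ℂ) ^ 2 := by
      rw [mul_conj', hκρ]; push_cast; ring
    have hne : conj (x.1 - a₀) ≠ 0 := by
      rw [map_ne_zero]; exact norm_pos_iff.1 h2
    have e3 : (κ : ℂ) ^ 2 * (conj x.2 - a₀) = x.1 - a₀ := by
      apply mul_left_cancel₀ hne
      linear_combination (κ : ℂ) ^ 2 * e1 - e2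
    field_simp
    linear_combination e3
  have hAx : A x = a₀ := by
    have : conj x.2 = x.1 + (x.1 - a₀) * ((1 - (κ : ℂ) ^ 2) / (κ : ℂ) ^ 2) := by rw [← hw]; ring
    have hκc : (κ : ℂ) ≠ 0 := by exact_mod_cast hκ0.ne'
    rw [hA]; simp only
    rw [this]
    field_simp
    ring
  have hRx : R x = ρ₀ := by
    rw [hR]; simp only
    have e1 : ‖(1 - (κ : ℂ) ^ 2) / (κ : ℂ) ^ 2‖ = (1 - κ ^ 2) / κ ^ 2 := by
      have : (1 - (κ : ℂ) ^ 2) / (κ : ℂ) ^ 2 = (((1 - κ ^ 2) / κ ^ 2 : ℝ) : ℂ) := by push_cast; rfl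
      rw [this, Complex.norm_real, Real.norm_of_nonneg (by positivity)]
    rw [hw, norm_mul, e1, hκρ]
    field_simp
  have hU : IsOpen {y | ‖A y‖ + r₁ < R y ∧ R y + ‖A y‖ < r₂} :=
    (isOpen_lt (hAc.norm.add continuous_const) hRc).inter
      (isOpen_lt (hRc.add hAc.norm) continuous_const)
  obtain ⟨r, hr, hrU⟩ := Metric.isOpen_iff.1 hU x (by
    show ‖A x‖ + r₁ < R x ∧ R x + ‖A x‖ < r₂
    rw [hAx, hRx]; exact h)
  refine ⟨κ, ⟨hκ0, hκ1⟩, r, hr, fun y hy => ⟨A y, R y, hrU hy, ?_⟩⟩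
  have hRy : 0 < R y := by
    have : ‖A y‖ + r₁ < R y := (hrU hy).1
    linarith [norm_nonneg (A y)]
  have e1 : y.1 - A y = (κ : ℂ) ^ 2 / (1 - (κ : ℂ) ^ 2) * (conj y.2 - y.1) := by
    rw [hA]; simp only; field_simp; ring
  have e2 : conj y.2 - A y = (conj y.2 - y.1) / (1 - (κ : ℂ) ^ 2) := by
    rw [hA]; simp only; field_simp; ring
  have e3 : y.2 - conj (A y) = conj (conj y.2 - y.1) / (1 - (κ : ℂ) ^ 2) := by
    have := congrArg conj e2
    simpa using this
  have e4 : ‖y.1 - A y‖ = κ * R y := by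
    have : (κ : ℂ) ^ 2 / (1 - (κ : ℂ) ^ 2) = ((κ ^ 2 / (1 - κ ^ 2) : ℝ) : ℂ) := by push_cast; rfl
    rw [e1, this, norm_mul, Complex.norm_real, Real.norm_of_nonneg (by positivity), hR]
    simp only; ring
  refine ⟨⟨?_, ?_, ?_⟩, e4⟩
  · rw [e1, e3, hR]
    push_cast
    have := mul_conj' (conj y.2 - y.1)
    field_simp
    linear_combination (κ : ℂ) ^ 2 * this
  · rw [e4]; positivity
  · rw [e4]; nlinarith

theorem isOpen_omegaPlus {r₁ r₂ : ℝ} (hr₁ : 0 < r₁) (hr₂ : 0 < r₂) :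
    IsOpen (omegaPlus (closedAnnulus r₁ r₂)) := by
  refine Metric.isOpen_iff.2 fun x hx => ?_
  obtain ⟨κ, -, r, hr, h⟩ := exists_ball_lambdaPlus hr₁ hr₂ hx
  refine ⟨r, hr, fun y hy => ?_⟩
  obtain ⟨a, ρ, h1, h2, -⟩ := h y hy
  exact (mem_omegaPlus_iff hr₁ hr₂).2 ⟨a, ρ, h1, h2⟩

/-! ### Approximating sequences and their limits -/

/-- Uniform approximation of functions with zero means by functions with an entire lift. -/
theorem exists_entireLift_norm_sub_le {r₁ r₂ : ℝ} (hr₁ : 0 < r₁) (hr : r₁ < r₂) {f : ℂ → ℂ}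
    (hf : ContinuousOn f (closedAnnulus r₁ r₂))
    (hmean : ∀ (a : ℂ) (ρ : ℝ), IsSurroundingCircle (closedAnnulus r₁ r₂) a ρ →
      Real.circleAverage f a ρ = 0) {ε : ℝ} (hε : 0 < ε) :
    ∃ p q : ℂ × ℂ → ℂ, (∀ k : ℕ, ContDiff ℂ k p) ∧ (∀ k : ℕ, ContDiff ℂ k q) ∧
      (∀ z, p (z, 0) = 0) ∧ (∀ z, q (z, 0) = 0) ∧
      ∀ z ∈ closedAnnulus r₁ r₂, ‖f z - (p (z, (conj z)⁻¹) + q (conj z, z⁻¹))‖ ≤ ε := by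
  have hr₂ := hr₁.trans hr
  have hsub : {ζ : ℂ | r₁ < ‖ζ‖ ∧ ‖ζ‖ < r₂} ⊆ closedAnnulus r₁ r₂ := fun _ h => ⟨h.1.le, h.2.le⟩
  -- Tietze extension: rotation averages are taken of a function continuous on the whole plane.
  obtain ⟨g, hg⟩ := ContinuousMap.exists_restrict_eq (isCompact_closedAnnulus r₁ r₂).isClosed
    ⟨_, hf.domRestrict⟩
  have hgf : ∀ z ∈ closedAnnulus r₁ r₂, g z = f z := fun z hz =>
    DFunLike.congr_fun hg (⟨z, hz⟩ : closedAnnulus r₁ r₂)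
  have hz : ZeroMeansOn r₁ r₂ g := by
    intro a ρ h1 h2
    have hρ : 0 < ρ := by linarith [norm_nonneg a]
    have hs := (sphere_subset_openAnnulus h1 h2).trans hsub
    have h3 := hmean a ρ ⟨hρ, hs, by simp; linarith⟩
    rw [Real.circleAverage_def, smul_eq_zero] at h3
    rw [← h3.resolve_left (by have := Real.pi_pos; positivity)]
    exact intervalIntegral.integral_congr fun θ _ => hgf _ (hs (circleMap_mem_sphere a hρ.le θ))
  obtain ⟨N, C, hC⟩ := exists_norm_sub_kernel_le g.continuous r₁ r₂ hε
  obtain ⟨p, q, hp, hq, hp0, hq0, hpq⟩ :=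
    (hz.hasEntireLift_kernel hr₁ hr₂ g.continuous N 0).const_mul C
  simp only [Int.cast_zero, zero_mul, neg_zero, Complex.exp_zero, one_mul] at hpq
  refine ⟨p, q, hp, hq, hp0, hq0, fun z hzA => ?_⟩
  have hne : ∀ z ∈ closedAnnulus r₁ r₂, z ≠ 0 := fun z hz => norm_pos_iff.1 (hr₁.trans_le hz.1)
  have hpc : ContinuousOn (fun z => p (z, (conj z)⁻¹)) (closedAnnulus r₁ r₂) :=
    (hp 0).continuous.comp_continuousOn (continuousOn_id.prodMk
      (continuous_conj.continuousOn.inv₀ fun z hz => (map_ne_zero _).2 (hne z hz)))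
  have hqc : ContinuousOn (fun z => q (conj z, z⁻¹)) (closedAnnulus r₁ r₂) :=
    (hq 0).continuous.comp_continuousOn (continuous_conj.continuousOn.prodMk
      (continuousOn_id.inv₀ hne))
  have hcl : closure {ζ : ℂ | r₁ < ‖ζ‖ ∧ ‖ζ‖ < r₂} ⊆ closedAnnulus r₁ r₂ :=
    closure_minimal hsub (isCompact_closedAnnulus r₁ r₂).isClosed
  refine le_on_closure (f := fun z => ‖f z - (p (z, (conj z)⁻¹) + q (conj z, z⁻¹))‖)
    (g := fun _ => ε) (fun z hz => ?_) ((hf.sub (hpc.add hqc)).norm.mono hcl) continuousOn_const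
    (closedAnnulus_subset_closure hr₁ hr hzA)
  rw [← hpq z hz, ← hgf z (hsub hz)]
  exact hC z (hsub hz)

/-- Entire functions `p n`, `q n` of `(z, w⁻¹)` whose sums, restricted to `w = conj z`, converge
uniformly to `f` on the annulus. -/
structure IsLiftSeq (r₁ r₂ : ℝ) (f : ℂ → ℂ) (p q : ℕ → ℂ × ℂ → ℂ) : Prop where
  contDiff_left : ∀ n, ∀ k : ℕ, ContDiff ℂ k (p n)
  contDiff_right : ∀ n, ∀ k : ℕ, ContDiff ℂ k (q n)
  left_zero : ∀ n z, p n (z, 0) = 0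
  right_zero : ∀ n z, q n (z, 0) = 0
  norm_sub_le : ∀ n, ∀ z ∈ closedAnnulus r₁ r₂,
    ‖f z - (p n (z, (conj z)⁻¹) + q n (conj z, z⁻¹))‖ ≤ 1 / (n + 1)

/-- Conjugating the variable exchanges `p` and `q`, so limits of `q` follow from those of `p`. -/
theorem IsLiftSeq.symm {r₁ r₂ : ℝ} {f : ℂ → ℂ} {p q : ℕ → ℂ × ℂ → ℂ}
    (h : IsLiftSeq r₁ r₂ f p q) : IsLiftSeq r₁ r₂ (fun z => f (conj z)) q p where
  contDiff_left := h.contDiff_right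
  contDiff_right := h.contDiff_left
  left_zero := h.right_zero
  right_zero := h.left_zero
  norm_sub_le n z hz := by
    have := h.norm_sub_le n (conj z) ⟨by simpa using hz.1, by simpa using hz.2⟩
    rw [conj_conj] at this
    rwa [add_comm (q n _)]

theorem uniformCauchySeqOn_of_dist_le {α : Type*} {F : ℕ → α → ℂ} {S : Set α} {C : ℝ}
    (h : ∀ m n, ∀ x ∈ S, dist (F m x) (F n x) ≤ C * (1 / (m + 1) + 1 / (n + 1))) :
    UniformCauchySeqOn F atTop S := by
  have hlim : Tendsto (fun x : ℕ × ℕ => C * (1 / ((x.1 : ℝ) + 1) + 1 / ((x.2 : ℝ) + 1)))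
      (atTop ×ˢ atTop) (𝓝 (C * (0 + 0))) :=
    ((tendsto_one_div_add_atTop_nhds_zero_nat.comp tendsto_fst).add
      (tendsto_one_div_add_atTop_nhds_zero_nat.comp tendsto_snd)).const_mul C
  rw [add_zero, mul_zero] at hlim
  intro u hu
  obtain ⟨ε, hε, hεu⟩ := Metric.mem_uniformity_dist.1 hu
  filter_upwards [hlim.eventually_lt_const hε] with x hx y hy
  exact hεu ((h x.1 x.2 y hy).trans_lt hx)

theorem IsLiftSeq.leaf_estimates_sub {r₁ r₂ : ℝ} (hr₁ : 0 < r₁) {f : ℂ → ℂ}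
    {p q : ℕ → ℂ × ℂ → ℂ} (h : IsLiftSeq r₁ r₂ f p q) (m n : ℕ) {a : ℂ} {ρ : ℝ}
    (h1 : ‖a‖ + r₁ < ρ) (h2 : ρ + ‖a‖ < r₂) {x : ℂ × ℂ} (hx : x ∈ lambdaPlus a ρ) :
    ‖(p m (x.1, x.2⁻¹) + q m (conj x.1, (conj x.2)⁻¹)) -
        (p n (x.1, x.2⁻¹) + q n (conj x.1, (conj x.2)⁻¹))‖ ≤
        (1 / (m + 1) + 1 / (n + 1) : ℝ) ∧
      ‖p m (x.1, x.2⁻¹) - p n (x.1, x.2⁻¹)‖ ≤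
        2 * (1 / (m + 1) + 1 / (n + 1)) * ‖x.1 - a‖ / (ρ - ‖x.1 - a‖) := by
  have key := leaf_estimates (p := p m - p n) (q := q m - q n) (a := a) (ρ := ρ)
    (M := 1 / (m + 1) + 1 / (n + 1)) (z := x.1) (w := x.2)
    (((h.contDiff_left m 1).differentiable (by simp)).sub
      ((h.contDiff_left n 1).differentiable (by simp)))
    (((h.contDiff_right m 1).differentiable (by simp)).sub
      ((h.contDiff_right n 1).differentiable (by simp)))
    (by simp [h.left_zero]) (by simp [h.right_zero]) (by linarith)
    (fun ζ hζ => by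
      have hA := sphere_subset_openAnnulus h1 h2 hζ
      have hA' : ζ ∈ closedAnnulus r₁ r₂ := ⟨hA.1.le, hA.2.le⟩
      have e1 := h.norm_sub_le m ζ hA'
      have e2 := h.norm_sub_le n ζ hA'
      rw [norm_sub_rev] at e1
      refine le_trans (le_of_eq ?_) ((norm_add_le _ _).trans (add_le_add e1 e2))
      simp only [Pi.sub_apply]
      congr 1; ring) hx
  refine ⟨le_trans (le_of_eq ?_) key.1, key.2⟩
  simp only [Pi.sub_apply]
  congr 1; ring

/-- The first components of a lift sequence converge to a holomorphic function on `Ω⁺`. -/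
theorem IsLiftSeq.exists_holomorphic_limit {r₁ r₂ : ℝ} (hr₁ : 0 < r₁) (hr₂ : 0 < r₂) {f : ℂ → ℂ}
    {p q : ℕ → ℂ × ℂ → ℂ} (h : IsLiftSeq r₁ r₂ f p q) :
    ∃ F : ℂ × ℂ → ℂ, (∀ k : ℕ, ContDiffOn ℂ k F (omegaPlus (closedAnnulus r₁ r₂))) ∧
      ∀ x ∈ omegaPlus (closedAnnulus r₁ r₂),
        Tendsto (fun n => p n (x.1, x.2⁻¹)) atTop (𝓝 (F x)) := by
  have hloc : ∀ x ∈ omegaPlus (closedAnnulus r₁ r₂), ∃ r > 0,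
      ball x r ⊆ omegaPlus (closedAnnulus r₁ r₂) ∧
      UniformCauchySeqOn (fun n (y : ℂ × ℂ) => p n (y.1, y.2⁻¹)) atTop (ball x r) := by
    intro x hx
    obtain ⟨κ, hκ, r, hr, hball⟩ := exists_ball_lambdaPlus hr₁ hr₂ hx
    refine ⟨r, hr, fun y hy => ?_, uniformCauchySeqOn_of_dist_le (C := 2 * κ / (1 - κ))
      fun m n y hy => ?_⟩
    · obtain ⟨a, ρ, h1, h2, -⟩ := hball y hy
      exact (mem_omegaPlus_iff hr₁ hr₂).2 ⟨a, ρ, h1, h2⟩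
    · obtain ⟨a, ρ, h1, h2, h3⟩ := hball y hy
      have hρ : 0 < ρ := by linarith [norm_nonneg a, h1.1]
      have hκ1 : 0 < 1 - κ := by linarith [hκ.2]
      rw [dist_eq_norm]
      refine (h.leaf_estimates_sub hr₁ m n h1.1 h1.2 h2).2.trans (le_of_eq ?_)
      -- With the ratio fixed at `κ`, the leaf bound no longer depends on the leaf.
      rw [h3, show ρ - κ * ρ = (1 - κ) * ρ by ring, ← mul_assoc, mul_div_mul_right _ _ hρ.ne']
      ring
  have hpt : ∀ x, ∃ l, x ∈ omegaPlus (closedAnnulus r₁ r₂) →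
      Tendsto (fun n => p n (x.1, x.2⁻¹)) atTop (𝓝 l) := by
    intro x
    by_cases hx : x ∈ omegaPlus (closedAnnulus r₁ r₂)
    · obtain ⟨r, hr, -, hc⟩ := hloc x hx
      obtain ⟨l, hl⟩ := cauchySeq_tendsto_of_complete (hc.cauchySeq (mem_ball_self hr))
      exact ⟨l, fun _ => hl⟩
    · exact ⟨0, fun hx' => absurd hx' hx⟩
  choose F hF using hpt
  refine ⟨F, fun k => contDiffOn_of_tendstoUniformlyOn_ball (isOpen_omegaPlus hr₁ hr₂) k
    (f := fun n (y : ℂ × ℂ) => p n (y.1, y.2⁻¹)) (fun n k => ?_) (fun x hx => ?_), hF⟩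
  · refine (h.contDiff_left n k).comp_contDiffOn (contDiff_fst.contDiffOn.prodMk
      (contDiff_snd.contDiffOn.inv fun x hx => ?_))
    exact norm_pos_iff.1 (hr₁.trans (lt_norm_snd_of_mem_omegaPlus hr₁ hr₂ hx))
  · obtain ⟨r, hr, hsub, hc⟩ := hloc x hx
    exact ⟨r, hr, hsub, hc.tendstoUniformlyOn_of_tendsto fun y hy => hF y (hsub hy)⟩

/-- The lifts converge uniformly on the closure of `Ω⁺`. -/
theorem IsLiftSeq.exists_continuous_limit {r₁ r₂ : ℝ} (hr₁ : 0 < r₁) (hr : r₁ < r₂) {f : ℂ → ℂ}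
    (hf : ContinuousOn f (closedAnnulus r₁ r₂))
    {p q : ℕ → ℂ × ℂ → ℂ} (h : IsLiftSeq r₁ r₂ f p q) :
    ∃ Ψ : ℂ × ℂ → ℂ, ContinuousOn Ψ (closure (omegaPlus (closedAnnulus r₁ r₂))) ∧
      (∃ M : ℝ, ∀ x ∈ closure (omegaPlus (closedAnnulus r₁ r₂)), ‖Ψ x‖ ≤ M) ∧
      (∀ x ∈ closure (omegaPlus (closedAnnulus r₁ r₂)),
        Tendsto (fun n => p n (x.1, x.2⁻¹) + q n (conj x.1, (conj x.2)⁻¹)) atTop (𝓝 (Ψ x))) ∧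
      ∀ z ∈ closedAnnulus r₁ r₂, Ψ (z, conj z) = f z := by
  have hr₂ := hr₁.trans hr
  set Ω := omegaPlus (closedAnnulus r₁ r₂) with hΩ
  set Φ : ℕ → ℂ × ℂ → ℂ := fun n x => p n (x.1, x.2⁻¹) + q n (conj x.1, (conj x.2)⁻¹) with hΦ
  have hne : ∀ x ∈ closure Ω, x.2 ≠ 0 := fun x hx =>
    norm_pos_iff.1 (hr₁.trans_le (le_norm_snd_of_mem_closure hr₁ hr₂ hx))
  have hΦc : ∀ n, ContinuousOn (Φ n) (closure Ω) := by
    intro n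
    refine ContinuousOn.add ((h.contDiff_left n 0).continuous.comp_continuousOn
      (continuous_fst.continuousOn.prodMk (continuous_snd.continuousOn.inv₀ hne)))
      ((h.contDiff_right n 0).continuous.comp_continuousOn
      ((continuous_conj.comp continuous_fst).continuousOn.prodMk
      ((continuous_conj.comp continuous_snd).continuousOn.inv₀ fun x hx => ?_)))
    simpa using hne x hx
  have hdist : ∀ m n, ∀ x ∈ closure Ω, dist (Φ m x) (Φ n x) ≤
      1 * (1 / (m + 1) + 1 / (n + 1)) := by
    intro m n x hx
    -- The leaf estimate holds on `Ω⁺`, uniformly over all leaves, and passes to the closure by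
    -- continuity of each `Φ n`.
    refine le_on_closure (f := fun x => dist (Φ m x) (Φ n x))
      (g := fun _ => 1 * (1 / ((m : ℝ) + 1) + 1 / ((n : ℝ) + 1))) (fun y hy => ?_)
      (continuous_dist.comp_continuousOn ((hΦc m).prodMk (hΦc n))) continuousOn_const hx
    obtain ⟨a, ρ, h1, h2⟩ := (mem_omegaPlus_iff hr₁ hr₂).1 hy
    rw [dist_eq_norm, one_mul]
    exact (h.leaf_estimates_sub hr₁ m n h1.1 h1.2 h2).1
  have hc := uniformCauchySeqOn_of_dist_le hdist
  have hpt : ∀ x, ∃ l, x ∈ closure Ω → Tendsto (fun n => Φ n x) atTop (𝓝 l) := by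
    intro x
    by_cases hx : x ∈ closure Ω
    · obtain ⟨l, hl⟩ := cauchySeq_tendsto_of_complete (hc.cauchySeq hx)
      exact ⟨l, fun _ => hl⟩
    · exact ⟨0, fun hx' => absurd hx' hx⟩
  choose Ψ hΨ using hpt
  have hu := hc.tendstoUniformlyOn_of_tendsto hΨ
  refine ⟨Ψ, hu.continuousOn (Frequently.of_forall hΦc), ?_, hΨ, fun z hz => ?_⟩
  · obtain ⟨B, hB⟩ := (isCompact_closedAnnulus r₁ r₂).exists_bound_of_continuousOn hf
    have hb0 : ∀ x ∈ closure Ω, ‖Φ 0 x‖ ≤ B + 1 := by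
      intro x hx
      refine le_on_closure (f := fun x => ‖Φ 0 x‖) (g := fun _ => B + 1) (fun y hy => ?_)
        (hΦc 0).norm continuousOn_const hx
      obtain ⟨a, ρ, h1, h2⟩ := (mem_omegaPlus_iff hr₁ hr₂).1 hy
      refine (leaf_estimates ((h.contDiff_left 0 1).differentiable (by simp))
        ((h.contDiff_right 0 1).differentiable (by simp)) (h.left_zero 0) (h.right_zero 0)
        (by linarith [h1.1]) (fun ζ hζ => ?_) h2).1
      have hA := sphere_subset_openAnnulus h1.1 h1.2 hζ
      have hA' : ζ ∈ closedAnnulus r₁ r₂ := ⟨hA.1.le, hA.2.le⟩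
      have e1 := h.norm_sub_le 0 ζ hA'
      rw [norm_sub_rev] at e1
      have e2 := norm_add_le (p 0 (ζ, (conj ζ)⁻¹) + q 0 (conj ζ, ζ⁻¹) - f ζ) (f ζ)
      rw [sub_add_cancel] at e2
      have e3 := hB ζ hA'
      norm_num at e1
      linarith
    refine ⟨B + 1 + 2, fun x hx => ?_⟩
    refine le_of_tendsto (hΨ x hx).norm (Eventually.of_forall fun n => ?_)
    have e1 := hdist n 0 x hx
    rw [dist_eq_norm] at e1
    have e2 := norm_add_le (Φ n x - Φ 0 x) (Φ 0 x)
    rw [sub_add_cancel] at e2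
    have e3 := hb0 x hx
    have e4 : 1 / ((n : ℝ) + 1) ≤ 1 := by
      rw [div_le_one (by positivity)]; linarith [n.cast_nonneg (α := ℝ)]
    norm_num at e1 e4
    linarith
  · have hmem : (z, conj z) ∈ closure Ω := conjLift_subset_closure hr₁ hr ⟨hz, rfl⟩
    refine tendsto_nhds_unique (hΨ _ hmem) ?_
    rw [tendsto_iff_dist_tendsto_zero]
    refine squeeze_zero (fun _ => dist_nonneg) (fun n => ?_)
      tendsto_one_div_add_atTop_nhds_zero_nat
    have := h.norm_sub_le n z hz
    rw [dist_comm, dist_eq_norm]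
    simpa [hΦ] using this

/-! ### Pluriharmonicity and the theorem -/

/-- The sum of a holomorphic and an antiholomorphic function is pluriharmonic. -/
theorem pluriharmonicOn_add_comp_conj {U : Set (ℂ × ℂ)} (hU : IsOpen U)
    (hUc : ∀ x ∈ U, (conj x.1, conj x.2) ∈ U) {u F G : ℂ × ℂ → ℂ} (hF : ContDiffOn ℂ 2 F U)
    (hG : ContDiffOn ℂ 2 G U) (hu : ∀ x ∈ U, u x = F x + G (conj x.1, conj x.2)) :
    PluriharmonicOn u U := by
  have hconj : ContDiff ℝ 2 fun x : ℂ × ℂ => (conj x.1, conj x.2) :=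
    (conjCLE.contDiff.comp contDiff_fst).prodMk (conjCLE.contDiff.comp contDiff_snd)
  refine ⟨?_, fun p v ζ hζ => ?_⟩
  · exact ((hF.restrict_scalars ℝ).add
      ((hG.restrict_scalars ℝ).comp hconj.contDiffOn hUc)).congr hu
  · set V : Set ℂ := {ζ : ℂ | p + ζ • v ∈ U} with hV
    have hline : Differentiable ℂ fun ζ : ℂ => p + ζ • v := by fun_prop
    have hVo : IsOpen V := hU.preimage hline.continuous
    have h1 : DifferentiableOn ℂ (fun ζ : ℂ => F (p + ζ • v)) V :=
      (hF.differentiableOn (by simp)).comp hline.differentiableOn fun _ h => h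
    have h2 : DifferentiableOn ℂ
        (fun ζ : ℂ => conj (G (conj (p + ζ • v).1, conj (p + ζ • v).2))) V := by
      intro ξ hξ
      have hd : DifferentiableAt ℂ G (conj (p + ξ • v).1, conj (p + ξ • v).2) :=
        (hG.differentiableOn (by simp)).differentiableAt (hU.mem_nhds (hUc _ hξ))
      exact ((differentiableAt_conj_comp_conj hd).comp ξ (hline ξ)).differentiableWithinAt
    have h3 := (h1.analyticAt (hVo.mem_nhds hζ)).harmonicAt.add
      (h2.analyticAt (hVo.mem_nhds hζ)).harmonicAt_conj
    refine (InnerProductSpace.harmonicAt_congr_nhds ?_).1 h3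
    filter_upwards [hVo.mem_nhds hζ] with ξ hξ
    simp [hu _ hξ]

theorem theorem7p1 (r₁ r₂ : ℝ) (hr₁ : 0 < r₁) (hr₂ : r₁ < r₂) (f : ℂ → ℂ)
    (hf : ContinuousOn f (closedAnnulus r₁ r₂))
    (hmean : ∀ (a : ℂ) (ρ : ℝ), IsSurroundingCircle (closedAnnulus r₁ r₂) a ρ →
      Real.circleAverage f a ρ = 0) :
    conjLift (closedAnnulus r₁ r₂) ⊆ closure (omegaPlus (closedAnnulus r₁ r₂)) ∧
    ∃ Fplus Fminus : ℂ × ℂ → ℂ,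
      DifferentiableOn ℂ Fplus (omegaPlus (closedAnnulus r₁ r₂)) ∧
      DifferentiableOn ℂ Fminus (omegaMinus (closedAnnulus r₁ r₂)) ∧
      ∃ Ψ : ℂ × ℂ → ℂ,
        ContinuousOn Ψ (closure (omegaPlus (closedAnnulus r₁ r₂))) ∧
        (∃ M : ℝ, ∀ p ∈ closure (omegaPlus (closedAnnulus r₁ r₂)), ‖Ψ p‖ ≤ M) ∧
        (∀ z w : ℂ, (z, w) ∈ omegaPlus (closedAnnulus r₁ r₂) →
          Ψ (z, w) = Fplus (z, w) + Fminus (conj w, conj z)) ∧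
        (∀ z ∈ closedAnnulus r₁ r₂, Ψ (z, conj z) = f z) ∧
        PluriharmonicOn Ψ (omegaPlus (closedAnnulus r₁ r₂)) := by
  have hr₂' := hr₁.trans hr₂
  have happ := fun n : ℕ => exists_entireLift_norm_sub_le hr₁ hr₂ hf hmean
    (ε := 1 / ((n : ℝ) + 1)) (by positivity)
  choose p q h1 h2 h3 h4 h5 using happ
  have h : IsLiftSeq r₁ r₂ f p q := ⟨h1, h2, h3, h4, h5⟩
  obtain ⟨F, hF, hFlim⟩ := h.exists_holomorphic_limit hr₁ hr₂'
  obtain ⟨G, hG, hGlim⟩ := h.symm.exists_holomorphic_limit hr₁ hr₂'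
  obtain ⟨Ψ, hΨc, hΨb, hΨlim, hΨf⟩ := h.exists_continuous_limit hr₁ hr₂ hf
  have hΨ : ∀ x ∈ omegaPlus (closedAnnulus r₁ r₂), Ψ x = F x + G (conj x.1, conj x.2) :=
    fun x hx => tendsto_nhds_unique (hΨlim x (subset_closure hx))
      ((hFlim x hx).add (hGlim _ (conj_mem_omegaPlus hr₁ hr₂' hx)))
  -- `G` lives on `Ω⁺`; composed with the exchange of coordinates it is holomorphic on `Ω⁻`, and its
  -- value at `(conj w, conj z)` is `G (conj z, conj w)`.
  refine ⟨conjLift_subset_closure hr₁ hr₂, F, fun x => G (x.2, x.1),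
    (hF 1).differentiableOn (by simp), ?_, Ψ, hΨc, hΨb, fun z w hzw => hΨ _ hzw, hΨf,
    pluriharmonicOn_add_comp_conj (isOpen_omegaPlus hr₁ hr₂')
      (fun x hx => conj_mem_omegaPlus hr₁ hr₂' hx) (hF 2) (hG 2) hΨ⟩
  exact ((hG 1).differentiableOn (by simp)).comp (f := fun x : ℂ × ℂ => (x.2, x.1))
    (by fun_prop) fun x hx => swap_mem_omegaPlus hr₁ hr₂' hx
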